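/- Let $\alpha\ge 1$ and $\beta\ge 2$. Let $Q=[0,1]\times[-1,0]\times[-1,0]$. For integers $n\ge 1$ and $1\le j\le 2^{\lfloor n\beta\rfloor}$ put $a_n=2^{-n-\lfloor n\beta\rfloor}$, $x_{nj}=2^{-n+1}-(j-1)a_n$, $C_n=\tfrac12 a_n^{\alpha}$ and $$R_{nj}=[x_{nj}-C_n,\,x_{nj}]\times[-2^{-n+1},0]\times[0,2^{-n}],\qquad T_{\alpha,\beta}=Q\cup\bigcup_{n\ge1}\bigcup_{j=1}^{2^{\lfloor n\beta\rfloor}}R_{nj},\qquad \mathcal S_{\alpha,\beta}=\partial T_{\alpha,\beta}\subset\mathbb R^3 .$$ A Jordan domain in $\mathbb R^3$ is a bounded domain whose boundary is homeomorphic to the sphere $S^2$ and divides space into two domains, the given one and its exterior, of which it is the common boundary. For a nonempty bounded set $E$ let $N_\delta(E)$ be the smallest number of sets of diameter at most $\delta$ covering $E$, and let $\overline{\dim}_M E=\limsup_{\delta\to0^+}\log N_\delta(E)/(-\log\delta)$ be its upper Minkowski dimension. For a surface $\mathcal S$ bounding a Jordan domain, let $G^+$ and $G^-$ be the bounded and the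 unbounded component of $\mathbb R^3\setminus\mathcal S$, let $r>0$ be any number such that $\mathcal S\subset\{|x|<r\}$, and let $G^*=G^-\cap\{|x|<r\}$. With $I_p(D)=\int_D \operatorname{dist}(x,\mathcal S)^{-p}\,dV(x)$ define $\mathfrak m^+(\mathcal S)=\sup\{p\in\mathbb R: I_p(G^+)<\infty\}$, $\mathfrak m^-(\mathcal S)=\sup\{p\in\mathbb R: I_p(G^*)<\infty\}$ and $\mathfrak m(\mathcal S)=\max\{\mathfrak m^+(\mathcal S),\mathfrak m^-(\mathcal S)\}$. (i) For all $\alpha\ge1$ and $\beta\ge2$, the interior of $T_{\alpha,\beta}$ is a Jordan domain with boundary $\mathcal S_{\alpha,\beta}$, and $$\overline{\dim}_M(\mathcal S_{\alpha,\beta})=\frac{3\beta}{\beta+1},\qquad \mathfrak m^+(\mathcal S_{\alpha,\beta})=1-\frac{\beta-2}{\alpha(\beta+1)} .$$ (ii) Let $d\in(2,3)$ and $\beta=d/(3-d)$. Then $\beta>2$, the class of surfaces $\{\mathcal S_{\alpha,\beta}:\alpha>1\}$ is uncountable, and every surface of this class satisfies $\overline{\dim}_M(\mathcal S_{\alpha,\beta})=d$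 and $\mathfrak m(\mathcal S_{\alpha,\beta})>3-d$. -/

import Mathlib

open MeasureTheory Filter Topology

noncomputable section

/-- Euclidean three-space, with its Euclidean distance and Lebesgue measure. -/
abbrev E3 : Type := EuclideanSpace ℝ (Fin 3)

/-- The axis-parallel box `[a, b] × [c, d] × [e, f]`. -/
def box3 (a b c d e f : ℝ) : Set E3 :=
  {x | x 0 ∈ Set.Icc a b ∧ x 1 ∈ Set.Icc c d ∧ x 2 ∈ Set.Icc e f}

/-- The unit cube `Q = [0, 1] × [-1, 0] × [-1, 0]`. -/
def baseCube : Set E3 := box3 0 1 (-1) 0 (-1) 0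

/-- `a_n = 2 ^ (-n - ⌊n β⌋)`: the length of the `2 ^ ⌊n β⌋` equal segments into which
`[2 ^ (-n), 2 ^ (-n + 1)]` is divided. -/
def segLength (β : ℝ) (n : ℕ) : ℝ := (1 / 2) ^ (n + ⌊(n : ℝ) * β⌋₊)

/-- `x_{n j}`: the right end point of the `j`-th of these segments, counted from the right,
starting with `x_{n 1} = 2 ^ (-n + 1)`. -/
def rightEnd (β : ℝ) (n j : ℕ) : ℝ := 2 * (1 / 2) ^ n - ((j : ℝ) - 1) * segLength β n

/-- `C_n = a_n ^ α / 2`: the thickness of the boxes of generation `n`. -/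
def thickness (α β : ℝ) (n : ℕ) : ℝ := (1 / 2) * segLength β n ^ α

/-- The box
`R_{n j} = [x_{n j} - C_n, x_{n j}] × [-2 ^ (-n + 1), 0] × [0, 2 ^ (-n)]`. -/
def thinBox (α β : ℝ) (n j : ℕ) : Set E3 :=
  box3 (rightEnd β n j - thickness α β n) (rightEnd β n j)
    (-(2 * (1 / 2) ^ n)) 0 0 ((1 / 2) ^ n)

/-- `T_{α, β}`: the unit cube together with all boxes `R_{n j}`,
`n ≥ 1`, `1 ≤ j ≤ 2 ^ ⌊n β⌋`. -/
def solidT (α β : ℝ) : Set E3 :=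
  baseCube ∪ ⋃ (n : ℕ) (_ : 1 ≤ n) (j : ℕ) (_ : 1 ≤ j ∧ j ≤ 2 ^ ⌊(n : ℝ) * β⌋₊), thinBox α β n j

/-- The surface `S_{α, β} = ∂ T_{α, β}`. -/
def surfaceS (α β : ℝ) : Set E3 := frontier (solidT α β)

/-- A Jordan domain in three-space: a bounded domain whose boundary is homeomorphic to the
two-sphere and divides space into two domains, the given one and its exterior, of which it is
the common boundary. -/
structure IsJordanDomain (G : Set E3) : Prop where
  isOpen : IsOpen G
  isConnected : IsConnected G
  isBounded : Bornology.IsBounded G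
  homeo_sphere : Nonempty (frontier G ≃ₜ Metric.sphere (0 : E3) 1)
  isConnected_exterior : IsConnected ((closure G)ᶜ)
  frontier_exterior : frontier ((closure G)ᶜ) = frontier G

/-- `N_δ(E)`: the smallest number of sets of diameter at most `δ` that cover `E`
(such finite covers exist when `E` is bounded and `δ > 0`). -/
def minCoverCard (E : Set E3) (δ : ℝ) : ℕ :=
  sInf {k : ℕ | ∃ U : Fin k → Set E3,
    (∀ i, Metric.ediam (U i) ≤ ENNReal.ofReal δ) ∧ E ⊆ ⋃ i, U i}

/-- The upper Minkowski dimension of a nonempty bounded set `E`: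
the upper limit of `log N_δ(E) / (-log δ)` as `δ` decreases to `0`. -/
def upperMinkowskiDim (E : Set E3) : EReal :=
  limsup (fun δ : ℝ => ((Real.log (minCoverCard E δ : ℝ) / (-Real.log δ) : ℝ) : EReal)) (𝓝[>] 0)

/-- `G⁺`: the union of the bounded connected components of the complement of `S` (a single
component when `S` bounds a Jordan domain). -/
def innerPart (S : Set E3) : Set E3 :=
  {x | x ∈ Sᶜ ∧ Bornology.IsBounded (connectedComponentIn Sᶜ x)}

/-- `G⁻`: the union of the unbounded connected components of the complement of `S` (a single
component when `S` bounds a Jordan domain). -/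
def outerPart (S : Set E3) : Set E3 :=
  {x | x ∈ Sᶜ ∧ ¬ Bornology.IsBounded (connectedComponentIn Sᶜ x)}

/-- `I_p(D) = ∫_D dist(x, S) ^ (-p) dV(x)`, with values in `[0, ∞]`. -/
def distIntegral (S D : Set E3) (p : ℝ) : ENNReal :=
  ∫⁻ x in D, (Metric.infEDist x S) ^ (-p) ∂volume

/-- The inner Marcinkiewicz exponent `𝔪⁺(S) = sup {p : I_p(G⁺) < ∞}`, a supremum in the
extended reals. -/
def innerMarcinkiewicz (S : Set E3) : EReal :=
  ⨆ (p : ℝ) (_ : distIntegral S (innerPart S) p < ⊤), (p : EReal)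

/-- The outer Marcinkiewicz exponent `𝔪⁻(S) = sup {p : I_p(G*) < ∞}`, where
`G* = G⁻ ∩ {|x| < r}` and `r` is such that `S` lies inside the ball of radius `r`. -/
def outerMarcinkiewicz (S : Set E3) (r : ℝ) : EReal :=
  ⨆ (p : ℝ) (_ : distIntegral S (outerPart S ∩ Metric.ball 0 r) p < ⊤), (p : EReal)

/-- The (absolute) Marcinkiewicz exponent `𝔪(S) = max {𝔪⁺(S), 𝔪⁻(S)}`. -/
def marcinkiewicz (S : Set E3) (r : ℝ) : EReal :=
  max (innerMarcinkiewicz S) (outerMarcinkiewicz S r)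

end

noncomputable section

/-! ### The parameters of the boxes -/

/-! The topology is settled by an explicit homeomorphism of space carrying `solidT α β` to the unit
cube. At height `z` every box is squeezed linearly towards its middle in the first coordinate
(`exists_contraction_field`) and its two ends in the second coordinate are moved inwards by `z / 4`
(`tilt`). Vertical walls become slopes, so the solid becomes the region below the graph of one
function, `roof`. This function is continuous because only finitely many boxes reach any given
positive height. Lowering the roof to height `0` gives the cube
(`exists_homeomorph_solidT_baseCube`), a convex body and hence equivalent to a ball; connectedness,
boundary and exterior are all read off from the ball.

For the dimension, the boxes of generation `n` have faces of size about `2 ^ (-n)` and spacing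
`a_n`, which is about `2 ^ (-n (β + 1))`. At scale `δ`, let `N` be the generation whose spacing is
about `δ`. The faces of each generation up to `N` need at most a constant times `δ ^ (-3 β / (β +
1))` sets, and so does a full cube of side `2 ^ (-N)` containing all later boxes. The number of
generations costs only a factor `-log δ` (`minCoverCard_surfaceS_le`). Conversely, at scale `a_n`
the right faces of generation `n` nearly fill a cube of side `2 ^ (-n)` and contain a separated grid
of `2 ^ (3 (⌊n β⌋ - 1))` points (`le_minCoverCard_surfaceS`).

For the inner exponent, the integral of `dist ^ (-p)` over a box of thickness `C_n` is comparable to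
`C_n ^ (1 - p) * 4 ^ (-n)`. Multiplied by the number of boxes this is `genWeight`, geometric in `n`
up to a bounded factor with ratio `2 ^ (β - 2 - α (1 - p) (β + 1))`. The weights are summable or
unbounded according to the sign of that exponent, which puts the threshold at the stated `p`. Part
(ii) is a substitution, the inner exponent alone being large enough; since it depends injectively on
`α`, it also tells the surfaces apart. -/

/-- The pairs `(n, j)` for which the box `R_{n j}` belongs to `T_{α, β}`. -/
def IsBoxIndex (β : ℝ) (i : ℕ × ℕ) : Prop :=
  1 ≤ i.1 ∧ 1 ≤ i.2 ∧ i.2 ≤ 2 ^ ⌊(i.1 : ℝ) * β⌋₊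

/-- The middle of the interval over which the box `R_{n j}` stands. -/
def boxCenter (α β : ℝ) (i : ℕ × ℕ) : ℝ := rightEnd β i.1 i.2 - thickness α β i.1 / 2

theorem mem_solidT {α β : ℝ} {x : E3} :
    x ∈ solidT α β ↔ x ∈ baseCube ∨ ∃ i, IsBoxIndex β i ∧ x ∈ thinBox α β i.1 i.2 := by
  simp only [solidT, IsBoxIndex, Set.mem_union, Set.mem_iUnion, exists_prop, Prod.exists]
  constructor
  · rintro (h | ⟨n, hn, j, hj, h⟩)
    · exact Or.inl h
    · exact Or.inr ⟨n, j, ⟨hn, hj.1, hj.2⟩, h⟩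
  · rintro (h | ⟨n, j, ⟨hn, hj1, hj2⟩, h⟩)
    · exact Or.inl h
    · exact Or.inr ⟨n, hn, j, ⟨hj1, hj2⟩, h⟩

theorem segLength_pos (β : ℝ) (n : ℕ) : 0 < segLength β n := by
  unfold segLength; positivity

theorem segLength_le_one (β : ℝ) (n : ℕ) : segLength β n ≤ 1 := by
  unfold segLength; exact pow_le_one₀ (by norm_num) (by norm_num)

theorem segLength_le (β : ℝ) (n : ℕ) : segLength β n ≤ (1 / 2) ^ n := by
  unfold segLength
  exact pow_le_pow_of_le_one (by norm_num) (by norm_num) (by omega)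

theorem segLength_mul (β : ℝ) (n : ℕ) :
    segLength β n * 2 ^ ⌊(n : ℝ) * β⌋₊ = (1 / 2) ^ n := by
  unfold segLength
  rw [pow_add, mul_assoc, ← mul_pow]; norm_num

theorem segLength_anti {β : ℝ} (hβ : 0 ≤ β) : Antitone (segLength β) := by
  intro n m h
  unfold segLength
  apply pow_le_pow_of_le_one (by norm_num) (by norm_num)
  have : ⌊(n : ℝ) * β⌋₊ ≤ ⌊(m : ℝ) * β⌋₊ := by gcongr
  omega

theorem thickness_pos (α β : ℝ) (n : ℕ) : 0 < thickness α β n := by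
  have := segLength_pos β n
  unfold thickness; positivity

theorem thickness_anti {α β : ℝ} (hα : 0 ≤ α) (hβ : 0 ≤ β) : Antitone (thickness α β) := by
  intro n m h
  unfold thickness
  have := segLength_anti hβ h
  have := segLength_pos β m
  gcongr

theorem two_mul_thickness_le {α : ℝ} (hα : 1 ≤ α) (β : ℝ) (n : ℕ) :
    2 * thickness α β n ≤ segLength β n := by
  have := Real.rpow_le_rpow_of_exponent_ge (segLength_pos β n) (segLength_le_one β n) hα
  rw [Real.rpow_one] at this
  unfold thickness; linarith

theorem rightEnd_le {β : ℝ} {i : ℕ × ℕ} (hi : IsBoxIndex β i) :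
    rightEnd β i.1 i.2 ≤ 2 * (1 / 2) ^ i.1 := by
  have h1 : (1 : ℝ) ≤ i.2 := by exact_mod_cast hi.2.1
  have := segLength_pos β i.1
  unfold rightEnd; nlinarith

theorem le_rightEnd {β : ℝ} {i : ℕ × ℕ} (hi : IsBoxIndex β i) :
    (1 / 2) ^ i.1 + segLength β i.1 ≤ rightEnd β i.1 i.2 := by
  have h1 : (i.2 : ℝ) ≤ 2 ^ ⌊(i.1 : ℝ) * β⌋₊ := by exact_mod_cast hi.2.2
  have := segLength_pos β i.1
  have h2 := segLength_mul β i.1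
  unfold rightEnd; nlinarith

theorem half_pow_le_half {n : ℕ} (hn : 1 ≤ n) : ((1 : ℝ) / 2) ^ n ≤ 1 / 2 := by
  simpa using pow_le_pow_of_le_one (by norm_num : (0 : ℝ) ≤ 1 / 2) (by norm_num) hn

theorem thickness_add_le_of_lt {α β : ℝ} (hα : 1 ≤ α) (hβ : 0 ≤ β) {i k : ℕ × ℕ}
    (hi : IsBoxIndex β i) (hk : IsBoxIndex β k) (h : i.1 < k.1) :
    thickness α β i.1 + thickness α β k.1 ≤ boxCenter α β i - boxCenter α β k := by
  have h1 := le_rightEnd hi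
  have h2 := rightEnd_le hk
  have h3 := thickness_anti (α := α) (by linarith) hβ h.le
  have h4 := two_mul_thickness_le hα β i.1
  have h5 : 2 * ((1 : ℝ) / 2) ^ k.1 ≤ (1 / 2) ^ i.1 := by
    have := pow_le_pow_of_le_one (by norm_num : (0 : ℝ) ≤ 1 / 2) (by norm_num) h
    rw [pow_succ] at this
    linarith
  unfold boxCenter
  linarith

/-- The factor `1 / 2` in `C_n` and `α ≥ 1` give `2 C_n ≤ a_n`, so centres are apart by at least
twice the sum of the half-widths. This slack makes the contraction field `1 / 2`-Lipschitz and
leaves empty space beside each right face. -/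
theorem thickness_add_le {α β : ℝ} (hα : 1 ≤ α) (hβ : 0 ≤ β) {i k : ℕ × ℕ}
    (hi : IsBoxIndex β i) (hk : IsBoxIndex β k) (h : i ≠ k) :
    thickness α β i.1 + thickness α β k.1 ≤ |boxCenter α β i - boxCenter α β k| := by
  rcases lt_trichotomy i.1 k.1 with h1 | h1 | h1
  · exact (thickness_add_le_of_lt hα hβ hi hk h1).trans (le_abs_self _)
  · obtain ⟨n, j⟩ := i
    obtain ⟨m, l⟩ := k
    simp only at h1
    subst h1
    have hne : (j : ℤ) - l ≠ 0 := by
      intro h'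
      apply h
      simp only [Prod.mk.injEq, true_and]
      omega
    have h2 : (1 : ℝ) ≤ |(j : ℝ) - l| := by
      have := Int.one_le_abs hne
      exact_mod_cast this
    have h3 : boxCenter α β (n, j) - boxCenter α β (n, l) = -(((j : ℝ) - l) * segLength β n) := by
      simp only [boxCenter, rightEnd]; ring
    rw [h3, abs_neg, abs_mul, abs_of_pos (segLength_pos β n)]
    have h4 := two_mul_thickness_le hα β n
    have := segLength_pos β n
    simp only
    nlinarith
  · rw [abs_sub_comm, add_comm]
    exact (thickness_add_le_of_lt hα hβ hk hi h1).trans (le_abs_self _)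

theorem mem_thinBox {α β : ℝ} {i : ℕ × ℕ} {x : E3} :
    x ∈ thinBox α β i.1 i.2 ↔ |x 0 - boxCenter α β i| ≤ thickness α β i.1 / 2 ∧
      (-(2 * (1 / 2) ^ i.1) ≤ x 1 ∧ x 1 ≤ 0) ∧ 0 ≤ x 2 ∧ x 2 ≤ (1 / 2) ^ i.1 := by
  simp only [thinBox, box3, Set.mem_ofPred_eq, Set.mem_Icc, abs_le, boxCenter]
  constructor
  · rintro ⟨⟨h1, h2⟩, h3, h4⟩
    exact ⟨⟨by linarith, by linarith⟩, h3, h4⟩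
  · rintro ⟨⟨h1, h2⟩, h3, h4⟩
    exact ⟨⟨by linarith, by linarith⟩, h3, h4⟩

theorem thinBox_subset {α β : ℝ} (hα : 1 ≤ α) {i : ℕ × ℕ} (hi : IsBoxIndex β i) :
    thinBox α β i.1 i.2 ⊆
      box3 0 (2 * (1 / 2) ^ i.1) (-(2 * (1 / 2) ^ i.1)) 0 0 ((1 / 2) ^ i.1) := by
  rintro x ⟨⟨h1, h2⟩, h3, h4⟩
  have := rightEnd_le hi
  have := le_rightEnd hi
  have := two_mul_thickness_le hα β i.1
  have := thickness_pos α β i.1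
  have : (0 : ℝ) < (1 / 2) ^ i.1 := by positivity
  exact ⟨⟨by linarith, by linarith⟩, h3, h4⟩

end

noncomputable section

/-! ### Homeomorphisms that change one coordinate -/

/-- A continuous function that increases with slope at least `1 / 2` in the coordinate `i` defines
a homeomorphism which moves only that coordinate. -/
theorem exists_homeomorph_update {ι : Type*} [DecidableEq ι] (i : ι) (F : (ι → ℝ) → ℝ)
    (hF : Continuous F)
    (hmono : ∀ v a b, a ≤ b →
      (b - a) / 2 ≤ F (Function.update v i b) - F (Function.update v i a)) :
    ∃ Φ : (ι → ℝ) ≃ₜ (ι → ℝ), ∀ v, Φ v = Function.update v i (F v) := by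
  have hsm : ∀ v, StrictMono fun s => F (Function.update v i s) := by
    intro v a b hab
    have := hmono v a b hab.le
    simp only
    linarith
  have hcu : ∀ v, Continuous fun s => F (Function.update v i s) := fun v =>
    hF.comp (continuous_const.update i continuous_id)
  have hsurj : ∀ v, Function.Surjective fun s => F (Function.update v i s) := by
    intro v
    apply (hcu v).surjective
    · apply tendsto_atTop_mono' atTop (f₁ := fun s => F (Function.update v i 0) + s / 2)
      · filter_upwards [eventually_ge_atTop 0] with s hs
        have := hmono v 0 s hs
        linarith
      · exact tendsto_atTop_add_const_left _ _ (tendsto_id.atTop_div_const (by norm_num))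
    · apply tendsto_atBot_mono' atBot (f₁ := fun s => F (Function.update v i 0) + s / 2)
      · filter_upwards [eventually_le_atBot 0] with s hs
        have := hmono v s 0 hs
        linarith
      · exact tendsto_atBot_add_const_left _ _ (tendsto_id.atBot_div_const (by norm_num))
  choose g hg using fun v : ι → ℝ => hsurj v (v i)
  simp only at hg
  have hgc : Continuous g := by
    rw [continuous_iff_continuousAt]
    intro v
    rw [ContinuousAt, Metric.tendsto_nhds]
    intro ε hε
    -- The inverse is continuous because the strict inequalities at `g v - ε` and `g v + ε` persist
    -- for nearby `w`, and monotonicity then traps `g w` between these values.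
    have h1 : F (Function.update v i (g v - ε)) < v i := by
      rw [← hg v]; exact hsm v (by linarith)
    have h2 : v i < F (Function.update v i (g v + ε)) := by
      conv_lhs => rw [← hg v]
      exact hsm v (by linarith)
    have c1 : ∀ s, Continuous fun w : ι → ℝ => F (Function.update w i s) := fun s =>
      hF.comp (continuous_id.update i continuous_const)
    filter_upwards [((c1 _).tendsto v).eventually_lt ((continuous_apply i).tendsto v) h1,
      ((continuous_apply i).tendsto v).eventually_lt ((c1 _).tendsto v) h2] with w hw1 hw2
    rw [← hg w] at hw1 hw2
    have h3 := (hsm w).lt_iff_lt.1 hw1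
    have h4 := (hsm w).lt_iff_lt.1 hw2
    rw [Real.dist_eq, abs_lt]
    constructor <;> linarith
  refine ⟨⟨⟨fun v => Function.update v i (F v), fun v => Function.update v i (g v), ?_, ?_⟩,
    ?_, ?_⟩, fun v => rfl⟩
  · intro v
    simp only [Function.update_idem]
    have : g (Function.update v i (F v)) = v i := by
      apply (hsm v).injective
      have := hg (Function.update v i (F v))
      simpa using this
    rw [this, Function.update_eq_self]
  · intro v
    simp only [Function.update_idem]
    rw [hg v, Function.update_eq_self]
  · exact continuous_id.update i hF
  · exact continuous_id.update i hgc

/-! ### Suprema of families that are finite above every positive level -/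

section iSup

variable {X ι : Type*} {g : ι → X → ℝ}

theorem bddAbove_of_finite_levels (hfin : ∀ ε > 0, {i | ∃ x, ε ≤ g i x}.Finite) (x : X) :
    BddAbove (Set.range fun i => g i x) := by
  have h1 := ((hfin 1 one_pos).image fun i => g i x).bddAbove
  obtain ⟨M, hM⟩ := h1
  refine ⟨max M 1, ?_⟩
  rintro _ ⟨i, rfl⟩
  by_cases h : 1 ≤ g i x
  · exact (hM ⟨i, ⟨x, h⟩, rfl⟩).trans (le_max_left _ _)
  · exact (not_le.1 h).le.trans (le_max_right _ _)

/-- A positive supremum is attained: only finitely many members exceed the level `z / 2`, and the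
others cannot contribute. -/
theorem le_iSup_iff_of_finite_levels [Nonempty ι] (hfin : ∀ ε > 0, {i | ∃ x, ε ≤ g i x}.Finite)
    {x : X} {z : ℝ} (hz : 0 < z) : z ≤ ⨆ i, g i x ↔ ∃ i, z ≤ g i x := by
  refine ⟨fun h => ?_, fun ⟨i, hi⟩ => hi.trans (le_ciSup (bddAbove_of_finite_levels hfin x) i)⟩
  by_contra! hcon
  have hS : {i | z / 2 ≤ g i x}.Finite :=
    (hfin (z / 2) (by positivity)).subset fun i hi => ⟨x, hi⟩
  rcases Set.eq_empty_or_nonempty {i | z / 2 ≤ g i x} with he | hne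
  · have : ⨆ i, g i x ≤ z / 2 := ciSup_le fun i => by
      by_contra! h'
      have : i ∈ {i | z / 2 ≤ g i x} := h'.le
      rw [he] at this
      exact this
    linarith
  · obtain ⟨k, hk, hmax⟩ := Set.exists_max_image _ (fun i => g i x) hS hne
    have : ⨆ i, g i x ≤ g k x := ciSup_le fun i => by
      by_cases h' : z / 2 ≤ g i x
      · exact hmax i h'
      · exact (not_le.1 h').le.trans hk
    linarith [hcon k]

/-- Lower semicontinuity holds for any supremum of continuous functions. Upper semicontinuity holds
because a superlevel set at a positive level is a finite union of closed sets; at other levels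
nonnegativity makes it trivial. -/
theorem continuous_iSup_of_finite_levels [Nonempty ι] [TopologicalSpace X]
    (hc : ∀ i, Continuous (g i)) (h0 : ∀ i x, 0 ≤ g i x)
    (hfin : ∀ ε > 0, {i | ∃ x, ε ≤ g i x}.Finite) : Continuous fun x => ⨆ i, g i x := by
  rw [OrderTopology.continuous_iff]
  intro a
  constructor
  · have : (fun x => ⨆ i, g i x) ⁻¹' Set.Ioi a = ⋃ i, {x | a < g i x} := by
      ext x
      simp [lt_ciSup_iff (bddAbove_of_finite_levels hfin x)]
    rw [this]
    exact isOpen_iUnion fun i => isOpen_lt continuous_const (hc i)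
  · rcases le_or_gt a 0 with ha | ha
    · have : (fun x => ⨆ i, g i x) ⁻¹' Set.Iio a = ∅ := by
        ext x
        have : 0 ≤ ⨆ i, g i x := Real.iSup_nonneg fun i => h0 i x
        simp only [Set.mem_preimage, Set.mem_Iio, Set.mem_empty_iff_false, iff_false, not_lt]
        linarith
      rw [this]
      exact isOpen_empty
    · rw [← isClosed_compl_iff]
      have : ((fun x => ⨆ i, g i x) ⁻¹' Set.Iio a)ᶜ =
          ⋃ i ∈ {i | ∃ x, a ≤ g i x}, {x | a ≤ g i x} := by
        ext x
        simp only [Set.mem_compl_iff, Set.mem_preimage, Set.mem_Iio, not_lt,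
          le_iSup_iff_of_finite_levels hfin ha, Set.mem_iUnion, Set.mem_ofPred_eq, exists_prop]
        exact ⟨fun ⟨i, hi⟩ => ⟨i, ⟨x, hi⟩, hi⟩, fun ⟨i, _, hi⟩ => ⟨i, hi⟩⟩
      rw [this]
      exact (hfin a ha).isClosed_biUnion fun i _ => isClosed_le continuous_const (hc i)

end iSup

/-! ### Straightening the boxes -/

/-- A `1 / 2`-Lipschitz displacement which contracts the interval under every box towards its
middle. -/
theorem exists_contraction_field {α β : ℝ} (hα : 1 ≤ α) (hβ : 0 ≤ β) :
    ∃ U : ℝ → ℝ, (∀ a b, a ≤ b → |U b - U a| ≤ (b - a) / 2) ∧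
      ∀ i, IsBoxIndex β i → ∀ x, |x - boxCenter α β i| ≤ thickness α β i.1 / 2 →
        U x = -(x - boxCenter α β i) / 2 := by
  classical
  set I : ℕ × ℕ → Set ℝ := fun i => {x | |x - boxCenter α β i| ≤ thickness α β i.1 / 2} with hI
  -- The two offsets are at most half of the separation of the centres, so the remaining half bounds
  -- `|x - y|` from below. This gives the Lipschitz bound across different intervals.
  have key : ∀ i k, IsBoxIndex β i → IsBoxIndex β k → ∀ x y, x ∈ I i → y ∈ I k → i ≠ k →
      |x - boxCenter α β i| + |y - boxCenter α β k| ≤ |x - y| := by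
    intro i k hi hk x y hx hy hne
    have h1 := thickness_add_le hα hβ hi hk hne
    have h2 : |boxCenter α β i - boxCenter α β k| ≤
        |x - boxCenter α β i| + |y - boxCenter α β k| + |x - y| := by
      have e : boxCenter α β i - boxCenter α β k =
          (x - y) - (x - boxCenter α β i) + (y - boxCenter α β k) := by ring
      rw [e]
      have := abs_add_le ((x - y) - (x - boxCenter α β i)) (y - boxCenter α β k)
      have := abs_sub (x - y) (x - boxCenter α β i)
      linarith
    simp only [hI, Set.mem_ofPred_eq] at hx hy
    linarith
  have uniq : ∀ i k, IsBoxIndex β i → IsBoxIndex β k → ∀ x, x ∈ I i → x ∈ I k → i = k := by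
    intro i k hi hk x hx hy
    by_contra hne
    have h1 := thickness_add_le hα hβ hi hk hne
    have h2 : |boxCenter α β i - boxCenter α β k| ≤
        |x - boxCenter α β i| + |x - boxCenter α β k| := by
      have := abs_sub (x - boxCenter α β k) (x - boxCenter α β i)
      rw [show (x - boxCenter α β k) - (x - boxCenter α β i) =
        boxCenter α β i - boxCenter α β k by ring] at this
      linarith
    have := thickness_pos α β i.1
    have := thickness_pos α β k.1
    simp only [hI, Set.mem_ofPred_eq] at hx hy
    linarith
  let f : ℝ → ℝ := fun x => if h : ∃ i, IsBoxIndex β i ∧ x ∈ I i then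
    -(x - boxCenter α β h.choose) / 2 else 0
  have hf : ∀ i, IsBoxIndex β i → ∀ x ∈ I i, f x = -(x - boxCenter α β i) / 2 := by
    intro i hi x hx
    have h : ∃ i, IsBoxIndex β i ∧ x ∈ I i := ⟨i, hi, hx⟩
    have := uniq _ _ h.choose_spec.1 hi x h.choose_spec.2 hx
    simp only [f, dif_pos h, this]
  have hL : LipschitzOnWith (1 / 2) f {x | ∃ i, IsBoxIndex β i ∧ x ∈ I i} := by
    apply LipschitzOnWith.of_dist_le_mul
    rintro x ⟨i, hi, hx⟩ y ⟨k, hk, hy⟩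
    rw [hf i hi x hx, hf k hk y hy, Real.dist_eq, Real.dist_eq]
    have hh : (((1 / 2 : NNReal)) : ℝ) = 1 / 2 := by norm_num
    rw [hh]
    by_cases hne : i = k
    · subst hne
      rw [show -(x - boxCenter α β i) / 2 - -(y - boxCenter α β i) / 2 = -((1 / 2) * (x - y)) by
        ring, abs_neg, abs_mul, abs_of_pos (by norm_num : (0 : ℝ) < 1 / 2)]
    · have h1 := key i k hi hk x y hx hy hne
      have h2 := abs_sub (y - boxCenter α β k) (x - boxCenter α β i)
      rw [show -(x - boxCenter α β i) / 2 - -(y - boxCenter α β k) / 2 =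
        (1 / 2) * ((y - boxCenter α β k) - (x - boxCenter α β i)) by ring, abs_mul,
        abs_of_pos (by norm_num : (0 : ℝ) < 1 / 2)]
      linarith
  obtain ⟨U, hU, hUf⟩ := hL.extend_real
  refine ⟨U, fun a b hab => ?_, fun i hi x hx => ?_⟩
  · have := hU.dist_le_mul b a
    rw [Real.dist_eq, Real.dist_eq, abs_of_nonneg (by linarith : 0 ≤ b - a)] at this
    have hh : (((1 / 2 : NNReal)) : ℝ) = 1 / 2 := by norm_num
    rw [hh] at this
    linarith
  · rw [← hUf ⟨i, hi, hx⟩, hf i hi x hx]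

end

noncomputable section

/-! ### ### The straightened solid as the region under a roof -/

theorem finite_isBoxIndex_le {β : ℝ} (hβ : 0 ≤ β) (N : ℕ) :
    {i | IsBoxIndex β i ∧ i.1 ≤ N}.Finite := by
  apply ((Set.finite_Iic N).prod (Set.finite_Iic (2 ^ ⌊(N : ℝ) * β⌋₊))).subset
  rintro ⟨n, j⟩ ⟨⟨h1, h2, h3⟩, h4⟩
  refine ⟨h4, h3.trans ?_⟩
  have : (n : ℝ) ≤ N := by exact_mod_cast h4
  gcongr
  norm_num

/-- The roof over the straightened box with index `i`. -/
def roofPiece (α β : ℝ) (i : ℕ × ℕ) (p : ℝ × ℝ) : ℝ :=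
  open Classical in
  if IsBoxIndex β i then
    max 0 (min (min ((1 / 2) ^ i.1) (2 - 4 * |p.1 - boxCenter α β i| / thickness α β i.1))
      (min (4 * (p.2 + 2 * (1 / 2) ^ i.1)) (-4 * p.2)))
  else 0

theorem roofPiece_nonneg (α β : ℝ) (i : ℕ × ℕ) (p : ℝ × ℝ) : 0 ≤ roofPiece α β i p := by
  unfold roofPiece
  split_ifs
  · exact le_max_left _ _
  · exact le_rfl

/-- The slopes in `roofPiece` are chosen so that its slice at height `z` is the base rectangle
scaled by `1 - z / 2` in the first direction and cut by `z / 4` at both ends in the second: exactly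
what the contraction field and `tilt` do to the box. -/
theorem le_roofPiece_iff {α β : ℝ} {i : ℕ × ℕ} {p : ℝ × ℝ} {z : ℝ} (hz : 0 < z) :
    z ≤ roofPiece α β i p ↔ IsBoxIndex β i ∧ z ≤ (1 / 2) ^ i.1 ∧
      |p.1 - boxCenter α β i| ≤ thickness α β i.1 / 2 * (1 - z / 2) ∧
      -(2 * (1 / 2) ^ i.1) + z / 4 ≤ p.2 ∧ p.2 ≤ -z / 4 := by
  have hC := thickness_pos α β i.1
  unfold roofPiece
  split_ifs with h
  · have : z ≤ 2 - 4 * |p.1 - boxCenter α β i| / thickness α β i.1 ↔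
        |p.1 - boxCenter α β i| ≤ thickness α β i.1 / 2 * (1 - z / 2) := by
      rw [le_sub_comm, div_le_iff₀ hC]
      constructor <;> intro <;> linarith
    rw [le_max_iff, le_min_iff, le_min_iff, le_min_iff, this]
    simp only [h, true_and, not_le.2 hz, false_or, and_assoc]
    refine and_congr_right fun _ => and_congr_right fun _ => and_congr ?_ ?_ <;>
    constructor <;> intro <;> linarith
  · simp [h, hz]

theorem continuous_roofPiece (α β : ℝ) (i : ℕ × ℕ) : Continuous (roofPiece α β i) := by
  unfold roofPiece
  split_ifs
  · fun_prop
  · exact continuous_const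

theorem finite_roofPiece_levels (α : ℝ) {β : ℝ} (hβ : 0 ≤ β) :
    ∀ ε > 0, {i | ∃ p, ε ≤ roofPiece α β i p}.Finite := by
  intro ε hε
  obtain ⟨N, hN⟩ := exists_pow_lt_of_lt_one hε (by norm_num : (1 : ℝ) / 2 < 1)
  refine (finite_isBoxIndex_le hβ N).subset ?_
  rintro i ⟨p, hp⟩
  rw [le_roofPiece_iff hε] at hp
  refine ⟨hp.1, ?_⟩
  by_contra! hlt
  have := pow_le_pow_of_le_one (by norm_num : (0 : ℝ) ≤ 1 / 2) (by norm_num) hlt.le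
  linarith [hp.2.1]

/-- The roof over the straightened solid. -/
def roof (α β : ℝ) (p : ℝ × ℝ) : ℝ := ⨆ i, roofPiece α β i p

theorem continuous_roof (α : ℝ) {β : ℝ} (hβ : 0 ≤ β) : Continuous (roof α β) :=
  continuous_iSup_of_finite_levels (continuous_roofPiece α β) (roofPiece_nonneg α β)
    (finite_roofPiece_levels α hβ)

theorem roof_nonneg (α β : ℝ) (p : ℝ × ℝ) : 0 ≤ roof α β p :=
  Real.iSup_nonneg fun i => roofPiece_nonneg α β i p

theorem le_roof_iff {α β : ℝ} (hβ : 0 ≤ β) {p : ℝ × ℝ} {z : ℝ} (hz : 0 < z) :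
    z ≤ roof α β p ↔ ∃ i, z ≤ roofPiece α β i p :=
  le_iSup_iff_of_finite_levels (finite_roofPiece_levels α hβ) hz

theorem roof_le_one {α β : ℝ} (hβ : 0 ≤ β) (p : ℝ × ℝ) : roof α β p ≤ 1 := by
  by_contra! h
  obtain ⟨i, hi⟩ := (le_roof_iff hβ (by linarith [roof_nonneg α β p])).1 (le_refl (roof α β p))
  rw [le_roofPiece_iff (by linarith)] at hi
  have := half_pow_le_half hi.1.1
  linarith [hi.2.1]

/-- The displacement in the second coordinate, at height `z`. -/
def tilt (y z : ℝ) : ℝ := max (-(max z 0) / 4) (min (max z 0 / 4) (-(max z 0) / 4 - y / 4))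

theorem tilt_slope {a b : ℝ} (h : a ≤ b) (z : ℝ) : (b - a) / 2 ≤ b + tilt b z - (a + tilt a z) := by
  unfold tilt
  grind

theorem tilt_of_nonpos {y z : ℝ} (hz : z ≤ 0) : tilt y z = 0 := by
  unfold tilt
  rw [max_eq_right hz]
  grind

/-- One displacement serves all boxes: it is `-z / 4` at `y = 0` and has already risen to `z / 4` at
`y = -2 z`. Boxes twice as deep as they are high satisfy `2 z ≤ w` at all their heights. -/
theorem mem_Icc_iff_tilt {y z w : ℝ} (hz : 0 < z) (hw : 2 * z ≤ w) :
    (-w ≤ y ∧ y ≤ 0) ↔ (-w + z / 4 ≤ y + tilt y z ∧ y + tilt y z ≤ -z / 4) := by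
  unfold tilt
  rw [max_eq_left hz.le]
  grind

theorem contract_iff {U : ℝ → ℝ} (hU : ∀ a b, a ≤ b → |U b - U a| ≤ (b - a) / 2) {c r z : ℝ}
    (hc : ∀ x, |x - c| ≤ r → U x = -(x - c) / 2) (hz : 0 ≤ z) (hz1 : z ≤ 1) (x : ℝ) :
    |x - c| ≤ r ↔ |x + z * U x - c| ≤ r * (1 - z / 2) := by
  have hpos : 0 < 1 - z / 2 := by linarith
  have e : ∀ x, |x - c| ≤ r → x + z * U x - c = (x - c) * (1 - z / 2) := by
    intro x hx
    rw [hc x hx]; ring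
  constructor
  · intro h
    rw [e x h, abs_mul, abs_of_pos hpos]
    gcongr
  · intro h
    -- `x₁` is the point of the interval with the same image as `x`; since `U` is `1 / 2`-Lipschitz
    -- and `z ≤ 1`, the map `x + z * U x` is injective, so `x₁ = x`.
    set x₁ := c + (x + z * U x - c) / (1 - z / 2) with hx₁
    have h1 : |x₁ - c| ≤ r := by
      rw [hx₁, add_sub_cancel_left, abs_div, abs_of_pos hpos, div_le_iff₀ hpos]
      exact h
    have h2 := e x₁ h1
    have h3 : x₁ + z * U x₁ = x + z * U x := by
      have : (x₁ - c) * (1 - z / 2) = x + z * U x - c := by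
        rw [hx₁, add_sub_cancel_left, div_mul_cancel₀ _ hpos.ne']
      linarith
    have h4 : x₁ = x := by
      rcases le_total x₁ x with hle | hle
      · have := (abs_le.1 (hU _ _ hle))
        nlinarith
      · have := (abs_le.1 (hU _ _ hle))
        nlinarith
    rwa [h4] at h1

/-- The vertical coordinate after lowering a roof of height `h` to height `0`. -/
def lowerRoof (h z : ℝ) : ℝ := max (min z ((z - h) / (1 + h))) (z - h)

theorem lower_slope {h : ℝ} (h0 : 0 ≤ h) (h1 : h ≤ 1) {a b : ℝ} (hab : a ≤ b) :
    (b - a) / 2 ≤ lowerRoof h b - lowerRoof h a := by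
  have key : (b - a) / 2 ≤ (b - h) / (1 + h) - (a - h) / (1 + h) := by
    rw [← sub_div, sub_sub_sub_cancel_right]
    apply div_le_div_of_nonneg_left <;> linarith
  unfold lowerRoof
  grind

/-- `lowerRoof h` is the identity below `-1`, maps `[-1, h]` affinely onto `[-1, 0]`, and is the
translation by `-h` above `h`. -/
theorem lower_mem_iff {h : ℝ} (h0 : 0 ≤ h) (z : ℝ) :
    (-1 ≤ lowerRoof h z ∧ lowerRoof h z ≤ 0) ↔ (-1 ≤ z ∧ z ≤ h) := by
  have hp : 0 < 1 + h := by linarith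
  have k1 : -1 ≤ (z - h) / (1 + h) ↔ -1 ≤ z := by
    rw [le_div_iff₀ hp]; constructor <;> intro <;> linarith
  have k2 : (z - h) / (1 + h) ≤ 0 ↔ z ≤ h := by
    rw [div_le_iff₀ hp]; constructor <;> intro <;> linarith
  unfold lowerRoof
  rw [le_max_iff, le_min_iff, max_le_iff, min_le_iff, k1, k2]
  grind

/-- At heights `≤ 0` nothing is moved and the solid is the cube. Above `0` the boxes correspond one
by one to roof pieces, and these already lie over the top face of the cube. -/
theorem mem_solidT_iff_roof {α β : ℝ} (hα : 1 ≤ α) (hβ : 0 ≤ β) {U : ℝ → ℝ}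
    (hU : ∀ a b, a ≤ b → |U b - U a| ≤ (b - a) / 2)
    (hUc : ∀ i, IsBoxIndex β i → ∀ x, |x - boxCenter α β i| ≤ thickness α β i.1 / 2 →
        U x = -(x - boxCenter α β i) / 2) (v : E3) {x y : ℝ}
    (hx : x = v 0 + max 0 (min 1 (v 2)) * U (v 0)) (hy : y = v 1 + tilt (v 1) (v 2)) :
    v ∈ solidT α β ↔ (0 ≤ x ∧ x ≤ 1) ∧ (-1 ≤ y ∧ y ≤ 0) ∧ -1 ≤ v 2 ∧ v 2 ≤ roof α β (x, y) := by
  rcases le_or_gt (v 2) 0 with hz | hz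
  · have hx' : x = v 0 := by
      rw [hx, min_eq_right (by linarith), max_eq_left hz]; ring
    have hy' : y = v 1 := by rw [hy, tilt_of_nonpos hz, add_zero]
    subst hx' hy'
    have := roof_nonneg α β (v 0, v 1)
    rw [mem_solidT]
    constructor
    · rintro (⟨h1, h2, h3⟩ | ⟨i, hi, h⟩)
      · exact ⟨h1, h2, h3.1, by linarith [h3.2]⟩
      · have := thinBox_subset hα hi h
        have h5 := half_pow_le_half hi.1
        obtain ⟨h1, h2, h3⟩ := this
        exact ⟨⟨h1.1, by linarith [h1.2]⟩, ⟨by linarith [h2.1], h2.2⟩, by linarith [h3.1],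
          by linarith⟩
    · rintro ⟨h1, h2, h3, h4⟩
      exact Or.inl ⟨h1, h2, h3, hz⟩
  · have hQ : v ∉ baseCube := fun h => not_le.2 hz h.2.2.2
    have key : ∀ i, (IsBoxIndex β i ∧ v ∈ thinBox α β i.1 i.2) ↔ v 2 ≤ roofPiece α β i (x, y) := by
      intro i
      rw [le_roofPiece_iff hz, mem_thinBox]
      refine and_congr_right fun hi => ?_
      constructor
      · rintro ⟨h1, h2, h3, h4⟩
        have h5 := half_pow_le_half hi.1
        have hx' : x = v 0 + v 2 * U (v 0) := by
          rw [hx, min_eq_right (by linarith), max_eq_right hz.le]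
        rw [mem_Icc_iff_tilt hz (by linarith), ← hy] at h2
        rw [contract_iff hU (hUc i hi) hz.le (by linarith), ← hx'] at h1
        exact ⟨h4, h1, h2⟩
      · rintro ⟨h4, h1, h2⟩
        have h5 := half_pow_le_half hi.1
        have hx' : x = v 0 + v 2 * U (v 0) := by
          rw [hx, min_eq_right (by linarith), max_eq_right hz.le]
        rw [hy, ← mem_Icc_iff_tilt hz (by linarith)] at h2
        rw [hx', ← contract_iff hU (hUc i hi) hz.le (by linarith)] at h1
        exact ⟨h1, h2, hz.le, h4⟩
    rw [mem_solidT, le_roof_iff hβ hz]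
    simp only [hQ, false_or, key]
    refine ⟨fun ⟨i, hi⟩ => ?_, fun h => h.2.2.2⟩
    have hi' := hi
    rw [le_roofPiece_iff hz] at hi'
    obtain ⟨h1, h2, h3, h4, h5⟩ := hi'
    have := rightEnd_le h1
    have := le_rightEnd h1
    have := two_mul_thickness_le hα β i.1
    have hC := thickness_pos α β i.1
    have := half_pow_le_half h1.1
    have : (0 : ℝ) < (1 / 2) ^ i.1 := by positivity
    have h6 : |x - boxCenter α β i| ≤ thickness α β i.1 / 2 := by
      refine h3.trans ?_
      nlinarith
    rw [abs_le] at h6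
    simp only [boxCenter] at h6
    simp only at h4 h5
    exact ⟨⟨by linarith, by linarith⟩, ⟨by linarith, by linarith⟩, by linarith, i, hi⟩

/-- The solid `T_{α, β}` is the image of the cube under a homeomorphism of space. -/
theorem exists_homeomorph_solidT_baseCube {α β : ℝ} (hα : 1 ≤ α) (hβ : 0 ≤ β) :
    ∃ Φ : E3 ≃ₜ E3, Φ ⁻¹' baseCube = solidT α β := by
  obtain ⟨U, hU, hUc⟩ := exists_contraction_field hα hβ
  have hUcont : Continuous U := by
    apply (LipschitzWith.of_dist_le_mul (K := 1 / 2) (f := U) ?_).continuous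
    intro a b
    have hh : (((1 / 2 : NNReal)) : ℝ) = 1 / 2 := by norm_num
    rw [hh, Real.dist_eq, Real.dist_eq]
    rcases le_total a b with h | h
    · have := hU a b h
      rw [abs_sub_comm (U a), abs_sub_comm a, abs_of_nonneg (by linarith : 0 ≤ b - a)]
      linarith
    · have := hU b a h
      rw [abs_of_nonneg (by linarith : 0 ≤ a - b)]
      linarith
  -- Clamping the height to `[0, 1]` keeps the slope at least `1 / 2` in all of space; no box
  -- reaches above height `1 / 2`, so the clamp is harmless.
  obtain ⟨Φ₁, h₁⟩ := exists_homeomorph_update (0 : Fin 3)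
    (fun v => v 0 + max 0 (min 1 (v 2)) * U (v 0)) (by fun_prop) (by
      intro v a b hab
      have := abs_le.1 (hU a b hab)
      have h0 : 0 ≤ max 0 (min 1 (v 2)) := le_max_left _ _
      have h1 : max 0 (min 1 (v 2)) ≤ 1 := max_le zero_le_one (min_le_left _ _)
      simp
      nlinarith)
  obtain ⟨Φ₂, h₂⟩ := exists_homeomorph_update (1 : Fin 3)
    (fun v => v 1 + tilt (v 1) (v 2)) (by unfold tilt; fun_prop) (by
      intro v a b hab
      simpa using tilt_slope hab (v 2))
  obtain ⟨Φ₃, h₃⟩ := exists_homeomorph_update (2 : Fin 3)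
    (fun v => lowerRoof (roof α β (v 0, v 1)) (v 2)) (by
      have := continuous_roof α hβ
      have hc : Continuous fun v : Fin 3 → ℝ => roof α β (v 0, v 1) := by fun_prop
      unfold lowerRoof
      refine (Continuous.min (by fun_prop) (((continuous_apply 2).sub hc).div₀
        (continuous_const.add hc) fun v => ne_of_gt ?_)).max ((continuous_apply 2).sub hc)
      have := roof_nonneg α β (v 0, v 1)
      simp only [Pi.add_apply]
      linarith) (by
      intro v a b hab
      simpa using lower_slope (roof_nonneg α β (v 0, v 1)) (roof_le_one hβ _) hab)
  let e := (EuclideanSpace.equiv (Fin 3) ℝ).toHomeomorph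
  refine ⟨e.trans (Φ₁.trans (Φ₂.trans (Φ₃.trans e.symm))), ?_⟩
  ext v
  rw [mem_solidT_iff_roof hα hβ hU hUc v rfl rfl, ← lower_mem_iff (roof_nonneg _ _ _)]
  have hev : ∀ i, e v i = v i := fun i => rfl
  have hes : ∀ (w : Fin 3 → ℝ) i, (e.symm w) i = w i := fun w i => rfl
  simp only [Set.mem_preimage, Homeomorph.trans_apply, baseCube, box3, Set.mem_ofPred_eq, hes,
    h₁, h₂, h₃, Set.mem_Icc]
  simp [hev]

end

noncomputable section

/-! ### Boxes -/

theorem continuous_coord (i : Fin 3) : Continuous fun x : E3 => x i := by fun_prop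

theorem isClosed_box3 (a b c d e f : ℝ) : IsClosed (box3 a b c d e f) :=
  (isClosed_Icc.preimage (continuous_coord 0)).inter
    ((isClosed_Icc.preimage (continuous_coord 1)).inter
      (isClosed_Icc.preimage (continuous_coord 2)))

theorem mem_interior_box3 {a b c d e f : ℝ} {x : E3} (h0 : x 0 ∈ Set.Ioo a b)
    (h1 : x 1 ∈ Set.Ioo c d) (h2 : x 2 ∈ Set.Ioo e f) : x ∈ interior (box3 a b c d e f) := by
  have ho : IsOpen {x : E3 | x 0 ∈ Set.Ioo a b ∧ x 1 ∈ Set.Ioo c d ∧ x 2 ∈ Set.Ioo e f} :=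
    (isOpen_Ioo.preimage (continuous_coord 0)).inter
      ((isOpen_Ioo.preimage (continuous_coord 1)).inter
        (isOpen_Ioo.preimage (continuous_coord 2)))
  refine mem_interior.2 ⟨_, fun y hy => ?_, ho, ⟨h0, h1, h2⟩⟩
  exact ⟨Set.Ioo_subset_Icc_self hy.1, Set.Ioo_subset_Icc_self hy.2.1,
    Set.Ioo_subset_Icc_self hy.2.2⟩

theorem convex_box3 (a b c d e f : ℝ) : Convex ℝ (box3 a b c d e f) := by
  intro x hx y hy s t hs ht hst
  refine ⟨?_, ?_, ?_⟩
  · exact (convex_Icc a b) hx.1 hy.1 hs ht hst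
  · exact (convex_Icc c d) hx.2.1 hy.2.1 hs ht hst
  · exact (convex_Icc e f) hx.2.2 hy.2.2 hs ht hst

theorem isBounded_box3 (a b c d e f : ℝ) : Bornology.IsBounded (box3 a b c d e f) := by
  have hK : IsCompact ((EuclideanSpace.equiv (Fin 3) ℝ).symm ''
      (Set.Icc ![a, c, e] ![b, d, f])) :=
    isCompact_Icc.image (EuclideanSpace.equiv (Fin 3) ℝ).symm.continuous
  refine hK.isBounded.subset fun x hx => ⟨EuclideanSpace.equiv (Fin 3) ℝ x, ?_, by simp⟩
  rw [Set.mem_Icc, Pi.le_def, Pi.le_def]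
  constructor <;> intro i <;> fin_cases i
  · exact hx.1.1
  · exact hx.2.1.1
  · exact hx.2.2.1
  · exact hx.1.2
  · exact hx.2.1.2
  · exact hx.2.2.2

theorem interior_baseCube_nonempty : (interior baseCube).Nonempty :=
  ⟨!₂[1 / 2, -1 / 2, -1 / 2], mem_interior_box3 (by simp; norm_num)
    (by simp; norm_num) (by simp; norm_num)⟩

/-! ### The interior of the solid is a Jordan domain -/

theorem one_lt_rank_E3 : 1 < Module.rank ℝ E3 := by
  rw [← Module.finrank_eq_rank]
  simp

theorem isConnected_compl_closedBall : IsConnected (Metric.closedBall (0 : E3) 1)ᶜ := by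
  have h1 : IsConnected (Set.Ioi (1 : ℝ) ×ˢ Metric.sphere (0 : E3) 1) :=
    isConnected_Ioi.prod (isConnected_sphere one_lt_rank_E3 0 zero_le_one)
  have h2 : (fun p : ℝ × E3 => p.1 • p.2) '' (Set.Ioi (1 : ℝ) ×ˢ Metric.sphere (0 : E3) 1) =
      (Metric.closedBall (0 : E3) 1)ᶜ := by
    ext x
    simp only [Set.mem_image, Set.mem_prod, Set.mem_Ioi, mem_sphere_zero_iff_norm, Prod.exists,
      Set.mem_compl_iff, mem_closedBall_zero_iff, not_le]
    constructor
    · rintro ⟨r, y, ⟨hr, hy⟩, rfl⟩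
      rw [norm_smul, hy, mul_one, Real.norm_eq_abs, abs_of_pos (by linarith)]
      exact hr
    · intro hx
      have hpos : 0 < ‖x‖ := by linarith
      refine ⟨‖x‖, ‖x‖⁻¹ • x, ⟨hx, ?_⟩, ?_⟩
      · rw [norm_smul, norm_inv, norm_norm, inv_mul_cancel₀ hpos.ne']
      · rw [smul_smul, mul_inv_cancel₀ hpos.ne', one_smul]
  rw [← h2]
  exact h1.image _ (by fun_prop)

theorem exists_homeomorph_solidT_closedBall {α β : ℝ} (hα : 1 ≤ α) (hβ : 0 ≤ β) :
    ∃ Ψ : E3 ≃ₜ E3, Ψ ⁻¹' Metric.closedBall 0 1 = solidT α β := by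
  obtain ⟨Φ, hΦ⟩ := exists_homeomorph_solidT_baseCube hα hβ
  obtain ⟨h, -, h2, -⟩ := exists_homeomorph_image_interior_closure_frontier_eq_unitBall
    (convex_box3 0 1 (-1) 0 (-1) 0) interior_baseCube_nonempty (isBounded_box3 _ _ _ _ _ _)
  rw [(isClosed_box3 _ _ _ _ _ _).closure_eq] at h2
  refine ⟨Φ.trans h, ?_⟩
  ext v
  rw [Set.mem_preimage, Homeomorph.trans_apply, ← Set.mem_preimage, ← h2, h.preimage_image, ← hΦ]
  rfl

theorem solidT_subset_box3 {α β : ℝ} (hα : 1 ≤ α) : solidT α β ⊆ box3 0 1 (-1) 0 (-1) 1 := by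
  intro x hx
  rcases mem_solidT.1 hx with h | ⟨i, hi, h⟩
  · exact ⟨h.1, h.2.1, h.2.2.1, h.2.2.2.trans zero_le_one⟩
  · obtain ⟨h1, h2, h3⟩ := thinBox_subset hα hi h
    have := half_pow_le_half hi.1
    exact ⟨⟨h1.1, by linarith [h1.2]⟩, ⟨by linarith [h2.1], h2.2⟩, by linarith [h3.1],
      by linarith [h3.2]⟩

theorem isBounded_solidT {α β : ℝ} (hα : 1 ≤ α) : Bornology.IsBounded (solidT α β) :=
  (isBounded_box3 _ _ _ _ _ _).subset (solidT_subset_box3 hα)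

theorem isClosed_solidT {α β : ℝ} (hα : 1 ≤ α) (hβ : 0 ≤ β) : IsClosed (solidT α β) := by
  obtain ⟨Ψ, hΨ⟩ := exists_homeomorph_solidT_closedBall hα hβ
  rw [← hΨ]
  exact Metric.isClosed_closedBall.preimage Ψ.continuous

theorem isConnected_interior_solidT {α β : ℝ} (hα : 1 ≤ α) (hβ : 0 ≤ β) :
    IsConnected (interior (solidT α β)) := by
  obtain ⟨Ψ, hΨ⟩ := exists_homeomorph_solidT_closedBall hα hβ
  rw [← hΨ, ← Ψ.preimage_interior, interior_closedBall _ one_ne_zero, Ψ.isConnected_preimage]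
  exact Metric.isConnected_ball one_pos

theorem isConnected_compl_solidT {α β : ℝ} (hα : 1 ≤ α) (hβ : 0 ≤ β) :
    IsConnected (solidT α β)ᶜ := by
  obtain ⟨Ψ, hΨ⟩ := exists_homeomorph_solidT_closedBall hα hβ
  rw [← hΨ, ← Set.preimage_compl, Ψ.isConnected_preimage]
  exact isConnected_compl_closedBall

theorem closure_interior_solidT {α β : ℝ} (hα : 1 ≤ α) (hβ : 0 ≤ β) :
    closure (interior (solidT α β)) = solidT α β := by
  obtain ⟨Ψ, hΨ⟩ := exists_homeomorph_solidT_closedBall hα hβ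
  rw [← hΨ, ← Ψ.preimage_interior, ← Ψ.preimage_closure, interior_closedBall _ one_ne_zero,
    closure_ball _ one_ne_zero]

theorem frontier_interior_solidT {α β : ℝ} (hα : 1 ≤ α) (hβ : 0 ≤ β) :
    frontier (interior (solidT α β)) = surfaceS α β := by
  rw [surfaceS, frontier, closure_interior_solidT hα hβ, interior_interior,
    (isClosed_solidT hα hβ).frontier_eq]

theorem isJordanDomain_interior_solidT {α β : ℝ} (hα : 1 ≤ α) (hβ : 0 ≤ β) :
    IsJordanDomain (interior (solidT α β)) where
  isOpen := isOpen_interior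
  isConnected := isConnected_interior_solidT hα hβ
  isBounded := (isBounded_solidT hα).subset interior_subset
  homeo_sphere := by
    rw [frontier_interior_solidT hα hβ]
    obtain ⟨Ψ, hΨ⟩ := exists_homeomorph_solidT_closedBall hα hβ
    refine ⟨Ψ.sets ?_⟩
    rw [surfaceS, ← hΨ, ← Ψ.preimage_frontier, frontier_closedBall _ one_ne_zero]
  isConnected_exterior := by
    rw [closure_interior_solidT hα hβ]
    exact isConnected_compl_solidT hα hβ
  frontier_exterior := by
    rw [closure_interior_solidT hα hβ, frontier_compl, frontier_interior_solidT hα hβ, surfaceS]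

theorem innerPart_surfaceS {α β : ℝ} (hα : 1 ≤ α) (hβ : 0 ≤ β) :
    innerPart (surfaceS α β) = interior (solidT α β) := by
  have hS : surfaceS α β = solidT α β \ interior (solidT α β) :=
    (isClosed_solidT hα hβ).frontier_eq
  have hint : interior (solidT α β) ⊆ (surfaceS α β)ᶜ := fun x hx h => by
    rw [hS] at h; exact h.2 hx
  have hext : (solidT α β)ᶜ ⊆ (surfaceS α β)ᶜ := fun x hx h => by
    rw [hS] at h; exact hx h.1
  have hunion : (surfaceS α β)ᶜ = interior (solidT α β) ∪ (solidT α β)ᶜ := by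
    ext x
    rw [hS]
    have := @interior_subset _ _ (solidT α β) x
    simp only [Set.mem_compl_iff, Set.mem_sdiff, Set.mem_union]
    tauto
  ext x
  constructor
  · rintro ⟨hx, hb⟩
    by_contra hxi
    have hxe : x ∈ (solidT α β)ᶜ := by
      rw [hunion] at hx
      exact hx.resolve_left hxi
    -- A bounded component through an exterior point would contain the whole connected exterior,
    -- making space bounded.
    have h1 := (isConnected_compl_solidT hα hβ).isPreconnected.subset_connectedComponentIn hxe hext
    have h2 := (hb.subset h1).union (isBounded_solidT (β := β) hα)
    rw [Set.compl_union_self] at h2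
    exact NormedSpace.unbounded_univ ℝ E3 h2
  · intro hx
    refine ⟨hint hx, (isBounded_solidT (β := β) hα).subset ?_⟩
    have hpre := isPreconnected_connectedComponentIn (F := (surfaceS α β)ᶜ) (x := x)
    have hsub := connectedComponentIn_subset (surfaceS α β)ᶜ x
    have := hpre.subset_left_of_subset_union isOpen_interior (isClosed_solidT hα hβ).isOpen_compl
      (Set.disjoint_left.2 fun y hy hy' => hy' (interior_subset hy)) (hunion ▸ hsub)
      ⟨x, mem_connectedComponentIn (hint hx), hx⟩
    exact this.trans interior_subset

end

noncomputable section

/-! ### Counting covers -/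

/-- `E` can be covered by at most `k` sets of diameter at most `δ`. -/
def HasCover (E : Set E3) (δ : ℝ) (k : ℕ) : Prop :=
  ∃ s : Finset (Set E3), s.card ≤ k ∧ (∀ U ∈ s, Metric.ediam U ≤ ENNReal.ofReal δ) ∧
    E ⊆ ⋃ U ∈ s, U

theorem HasCover.mono {E F : Set E3} {δ : ℝ} {k l : ℕ} (h : HasCover F δ k) (hE : E ⊆ F)
    (hkl : k ≤ l) : HasCover E δ l := by
  obtain ⟨s, h1, h2, h3⟩ := h
  exact ⟨s, h1.trans hkl, h2, hE.trans h3⟩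

theorem HasCover.union {E F : Set E3} {δ : ℝ} {k l : ℕ} (hE : HasCover E δ k)
    (hF : HasCover F δ l) : HasCover (E ∪ F) δ (k + l) := by
  classical
  obtain ⟨s, h1, h2, h3⟩ := hE
  obtain ⟨t, h4, h5, h6⟩ := hF
  refine ⟨s ∪ t, (Finset.card_union_le s t).trans (add_le_add h1 h4), ?_, ?_⟩
  · intro U hU
    rcases Finset.mem_union.1 hU with h | h
    exacts [h2 U h, h5 U h]
  · rintro x (hx | hx)
    · obtain ⟨U, hU, hxU⟩ := Set.mem_iUnion₂.1 (h3 hx)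
      exact Set.mem_iUnion₂.2 ⟨U, Finset.mem_union_left _ hU, hxU⟩
    · obtain ⟨U, hU, hxU⟩ := Set.mem_iUnion₂.1 (h6 hx)
      exact Set.mem_iUnion₂.2 ⟨U, Finset.mem_union_right _ hU, hxU⟩

theorem HasCover.biUnion {ι : Type*} {t : Finset ι} {E : ι → Set E3} {δ : ℝ} {k : ι → ℕ}
    (h : ∀ i ∈ t, HasCover (E i) δ (k i)) : HasCover (⋃ i ∈ t, E i) δ (∑ i ∈ t, k i) := by
  classical
  induction t using Finset.induction_on with
  | empty => exact ⟨∅, by simp, by simp, by simp⟩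
  | insert a t ha ih =>
    rw [Finset.sum_insert ha, Finset.set_biUnion_insert]
    exact (h a (Finset.mem_insert_self a t)).union
      (ih fun i hi => h i (Finset.mem_insert_of_mem hi))

theorem HasCover.minCoverCard_le {E : Set E3} {δ : ℝ} {k : ℕ} (h : HasCover E δ k) :
    minCoverCard E δ ≤ k := by
  obtain ⟨s, h1, h2, h3⟩ := h
  unfold minCoverCard
  refine le_trans (Nat.sInf_le (m := s.card) ?_) h1
  refine ⟨fun i => (s.equivFin.symm i : Set E3), ?_, ?_⟩
  · intro i
    exact h2 _ (s.equivFin.symm i).2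
  · intro x hx
    obtain ⟨U, hU, hxU⟩ := Set.mem_iUnion₂.1 (h3 hx)
    exact Set.mem_iUnion.2 ⟨s.equivFin ⟨U, hU⟩, by simpa using hxU⟩

/-- A set of diameter at most `δ` holds at most one of the points. Some finite cover must be
supplied, since the infimum of an empty set of naturals is `0`. -/
theorem HasCover.card_le_minCoverCard {E : Set E3} {δ : ℝ} (hδ : 0 ≤ δ) {k : ℕ}
    (h : HasCover E δ k) {ι : Type*} [Fintype ι] {P : ι → E3} (hP : ∀ i, P i ∈ E)
    (hsep : ∀ i j, i ≠ j → δ < dist (P i) (P j)) : Fintype.card ι ≤ minCoverCard E δ := by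
  have hne : {k : ℕ | ∃ U : Fin k → Set E3,
      (∀ i, Metric.ediam (U i) ≤ ENNReal.ofReal δ) ∧ E ⊆ ⋃ i, U i}.Nonempty := by
    obtain ⟨s, h1, h2, h3⟩ := h
    refine ⟨s.card, fun i => (s.equivFin.symm i : Set E3), fun i => h2 _ (s.equivFin.symm i).2, ?_⟩
    intro x hx
    obtain ⟨U, hU, hxU⟩ := Set.mem_iUnion₂.1 (h3 hx)
    exact Set.mem_iUnion.2 ⟨s.equivFin ⟨U, hU⟩, by simpa using hxU⟩
  obtain ⟨U, hU, hcov⟩ := Nat.sInf_mem hne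
  have hex : ∀ i, ∃ m, P i ∈ U m := fun i => Set.mem_iUnion.1 (hcov (hP i))
  choose f hf using hex
  have hinj : Function.Injective f := by
    intro i j hij
    by_contra hne
    have h1 := hsep i j hne
    have h2 : edist (P i) (P j) ≤ ENNReal.ofReal δ :=
      (Metric.edist_le_ediam_of_mem (hf i) (hij ▸ hf j)).trans (hU _)
    rw [edist_dist, ENNReal.ofReal_le_ofReal_iff hδ] at h2
    linarith
  have := Fintype.card_le_of_injective f hinj
  rwa [Fintype.card_fin] at this

theorem abs_coord_sub_le_dist (x y : E3) (i : Fin 3) : |x i - y i| ≤ dist x y := by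
  rw [dist_eq_norm, ← Real.norm_eq_abs]
  exact PiLp.norm_apply_le (x - y) i

theorem ediam_box3_le {a c e t : ℝ} (ht : 0 ≤ t) :
    Metric.ediam (box3 a (a + t) c (c + t) e (e + t)) ≤ ENNReal.ofReal (2 * t) := by
  refine Metric.ediam_le fun x hx y hy => ?_
  rw [edist_dist]
  apply ENNReal.ofReal_le_ofReal
  rw [EuclideanSpace.dist_eq, Real.sqrt_le_left (by positivity), Fin.sum_univ_three]
  obtain ⟨⟨h1, h2⟩, ⟨h3, h4⟩, h5, h6⟩ := hx
  obtain ⟨⟨k1, k2⟩, ⟨k3, k4⟩, k5, k6⟩ := hy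
  have q : ∀ u v s : ℝ, s ≤ u → u ≤ s + t → s ≤ v → v ≤ s + t → dist u v ^ 2 ≤ t ^ 2 := by
    intro u v s a1 a2 a3 a4
    rw [Real.dist_eq, sq_abs, sq_le_sq, abs_of_nonneg ht, abs_le]
    constructor <;> linarith
  have := q _ _ _ h1 h2 k1 k2
  have := q _ _ _ h3 h4 k3 k4
  have := q _ _ _ h5 h6 k5 k6
  nlinarith

/-- The number of grid intervals of length `δ / 2` used to cover an interval of length `L`. -/
def gridCount (L δ : ℝ) : ℕ := ⌊L / (δ / 2)⌋₊ + 1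

theorem hasCover_box3 (a b c d e f : ℝ) {δ : ℝ} (hδ : 0 < δ) :
    HasCover (box3 a b c d e f) δ
      (gridCount (b - a) δ * (gridCount (d - c) δ * gridCount (f - e) δ)) := by
  classical
  let cell : ℕ × ℕ × ℕ → Set E3 := fun q =>
    box3 (a + q.1 * (δ / 2)) (a + q.1 * (δ / 2) + δ / 2)
      (c + q.2.1 * (δ / 2)) (c + q.2.1 * (δ / 2) + δ / 2)
      (e + q.2.2 * (δ / 2)) (e + q.2.2 * (δ / 2) + δ / 2)
  refine ⟨((Finset.range (gridCount (b - a) δ)) ×ˢ ((Finset.range (gridCount (d - c) δ)) ×ˢ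
    (Finset.range (gridCount (f - e) δ)))).image cell, ?_, ?_, ?_⟩
  · refine Finset.card_image_le.trans ?_
    simp [Finset.card_product]
  · intro U hU
    obtain ⟨q, -, rfl⟩ := Finset.mem_image.1 hU
    refine (ediam_box3_le (by positivity)).trans (le_of_eq ?_)
    congr 1; ring
  · intro x hx
    have key : ∀ u s t : ℝ, u ∈ Set.Icc s t → ∃ q ∈ Finset.range (gridCount (t - s) δ),
        u ∈ Set.Icc (s + q * (δ / 2)) (s + q * (δ / 2) + δ / 2) := by
      intro u s t hu
      have h2 : (0 : ℝ) < δ / 2 := by positivity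
      have h0 : 0 ≤ (u - s) / (δ / 2) := div_nonneg (by linarith [hu.1]) h2.le
      refine ⟨⌊(u - s) / (δ / 2)⌋₊, ?_, ?_, ?_⟩
      · rw [Finset.mem_range, gridCount, Nat.lt_succ_iff]
        apply Nat.floor_le_floor
        gcongr
        exact hu.2
      · have := Nat.floor_le h0
        rw [le_div_iff₀ h2] at this
        linarith
      · have := (Nat.lt_floor_add_one ((u - s) / (δ / 2))).le
        rw [div_le_iff₀ h2] at this
        linarith
    obtain ⟨q₁, m₁, h₁⟩ := key _ _ _ hx.1
    obtain ⟨q₂, m₂, h₂⟩ := key _ _ _ hx.2.1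
    obtain ⟨q₃, m₃, h₃⟩ := key _ _ _ hx.2.2
    refine Set.mem_iUnion₂.2 ⟨cell (q₁, q₂, q₃), Finset.mem_image_of_mem _ ?_, h₁, h₂, h₃⟩
    simp only [Finset.mem_product]
    exact ⟨m₁, m₂, m₃⟩

theorem gridCount_mono {L M δ : ℝ} (hδ : 0 < δ) (h : L ≤ M) : gridCount L δ ≤ gridCount M δ := by
  unfold gridCount
  gcongr

theorem gridCount_sub_self (a δ : ℝ) : gridCount (a - a) δ = 1 := by
  simp [gridCount]

theorem gridCount_le {L δ : ℝ} (hδ : 0 < δ) (h : δ ≤ L) : (gridCount L δ : ℝ) ≤ 3 * (L / δ) := by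
  have h0 : 0 ≤ L / (δ / 2) := div_nonneg (by linarith) (by linarith)
  have h1 := Nat.floor_le h0
  have h2 : 1 ≤ L / δ := (one_le_div hδ).2 h
  have h3 : L / (δ / 2) = 2 * (L / δ) := by field_simp
  unfold gridCount
  push_cast
  linarith

theorem hasCover_box3_cube {a b c d e f L δ : ℝ} (hδ : 0 < δ) (h1 : b - a ≤ L) (h2 : d - c ≤ L)
    (h3 : f - e ≤ L) : HasCover (box3 a b c d e f) δ (gridCount L δ ^ 3) := by
  refine (hasCover_box3 a b c d e f hδ).mono le_rfl ?_
  rw [pow_succ', pow_two]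
  exact Nat.mul_le_mul (gridCount_mono hδ h1)
    (Nat.mul_le_mul (gridCount_mono hδ h2) (gridCount_mono hδ h3))

theorem hasCover_box3_diff_interior {a b c d e f L δ : ℝ} (hδ : 0 < δ) (h1 : b - a ≤ L)
    (h2 : d - c ≤ L) (h3 : f - e ≤ L) :
    HasCover (box3 a b c d e f \ interior (box3 a b c d e f)) δ (6 * gridCount L δ ^ 2) := by
  have g1 := gridCount_mono hδ h1
  have g2 := gridCount_mono hδ h2
  have g3 := gridCount_mono hδ h3
  have X : ∀ u, HasCover (box3 u u c d e f) δ (gridCount L δ ^ 2) := fun u =>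
    (hasCover_box3 u u c d e f hδ).mono le_rfl (by
      rw [gridCount_sub_self, one_mul, pow_two]; exact Nat.mul_le_mul g2 g3)
  have Y : ∀ u, HasCover (box3 a b u u e f) δ (gridCount L δ ^ 2) := fun u =>
    (hasCover_box3 a b u u e f hδ).mono le_rfl (by
      rw [gridCount_sub_self, one_mul, pow_two]; exact Nat.mul_le_mul g1 g3)
  have Z : ∀ u, HasCover (box3 a b c d u u) δ (gridCount L δ ^ 2) := fun u =>
    (hasCover_box3 a b c d u u hδ).mono le_rfl (by
      rw [gridCount_sub_self, mul_one, pow_two]; exact Nat.mul_le_mul g1 g2)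
  refine (((X a).union (X b)).union (((Y c).union (Y d)).union ((Z e).union (Z f)))).mono ?_
    (by linarith)
  rintro x ⟨⟨⟨p1, p2⟩, ⟨p3, p4⟩, p5, p6⟩, hx⟩
  by_contra hcon
  simp only [Set.mem_union, box3, Set.mem_ofPred_eq, Set.mem_Icc, not_or] at hcon
  obtain ⟨⟨q1, q2⟩, ⟨q3, q4⟩, q5, q6⟩ := hcon
  refine hx (mem_interior_box3 ⟨lt_of_le_of_ne p1 ?_, lt_of_le_of_ne p2 ?_⟩
    ⟨lt_of_le_of_ne p3 ?_, lt_of_le_of_ne p4 ?_⟩ ⟨lt_of_le_of_ne p5 ?_, lt_of_le_of_ne p6 ?_⟩)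
  · intro h; exact q1 ⟨⟨h.le, h.ge⟩, ⟨p3, p4⟩, p5, p6⟩
  · intro h; exact q2 ⟨⟨h.ge, h.le⟩, ⟨p3, p4⟩, p5, p6⟩
  · intro h; exact q3 ⟨⟨p1, p2⟩, ⟨h.le, h.ge⟩, p5, p6⟩
  · intro h; exact q4 ⟨⟨p1, p2⟩, ⟨h.ge, h.le⟩, p5, p6⟩
  · intro h; exact q5 ⟨⟨p1, p2⟩, ⟨p3, p4⟩, h.le, h.ge⟩
  · intro h; exact q6 ⟨⟨p1, p2⟩, ⟨p3, p4⟩, h.ge, h.le⟩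

/-! ### The surface -/

theorem surfaceS_eq_diff {α β : ℝ} (hα : 1 ≤ α) (hβ : 0 ≤ β) :
    surfaceS α β = solidT α β \ interior (solidT α β) :=
  (isClosed_solidT hα hβ).frontier_eq

theorem baseCube_subset (α β : ℝ) : baseCube ⊆ solidT α β := Set.subset_union_left

theorem thinBox_subset_solidT (α : ℝ) {β : ℝ} {i : ℕ × ℕ} (hi : IsBoxIndex β i) :
    thinBox α β i.1 i.2 ⊆ solidT α β := fun _ hx => mem_solidT.2 (Or.inr ⟨i, hi, hx⟩)

/-- A surface point in a piece of the solid is never interior to that piece, so early boxes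
contribute only their faces. Later boxes, having sides at most `2 ^ (-N)`, are swallowed whole by
one cube. -/
theorem surfaceS_subset {α β : ℝ} (hα : 1 ≤ α) (hβ : 0 ≤ β) (N : ℕ) :
    surfaceS α β ⊆ (baseCube \ interior baseCube) ∪
      ((⋃ n ∈ Finset.Icc 1 N, ⋃ j ∈ Finset.Icc 1 (2 ^ ⌊(n : ℝ) * β⌋₊),
        (thinBox α β n j \ interior (thinBox α β n j))) ∪
      box3 0 ((1 / 2) ^ N) (-((1 / 2) ^ N)) 0 0 ((1 / 2) ^ N)) := by
  rw [surfaceS_eq_diff hα hβ]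
  rintro x ⟨hx, hx'⟩
  rcases mem_solidT.1 hx with h | ⟨⟨n, j⟩, hi, h⟩
  · exact Or.inl ⟨h, fun h' => hx' (interior_mono (baseCube_subset α β) h')⟩
  · right
    rcases le_or_gt n N with hn | hn
    · left
      refine Set.mem_iUnion₂.2 ⟨n, Finset.mem_Icc.2 ⟨hi.1, hn⟩, Set.mem_iUnion₂.2
        ⟨j, Finset.mem_Icc.2 hi.2, h, fun h' => hx' ?_⟩⟩
      exact interior_mono (thinBox_subset_solidT α hi) h'
    · right
      obtain ⟨h1, h2, h3⟩ := thinBox_subset hα hi h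
      have h4 : 2 * ((1 : ℝ) / 2) ^ n ≤ (1 / 2) ^ N := by
        have := pow_le_pow_of_le_one (by norm_num : (0 : ℝ) ≤ 1 / 2) (by norm_num) hn
        rw [Nat.succ_eq_add_one, pow_succ] at this
        linarith
      have h5 : (0 : ℝ) < (1 / 2) ^ n := by positivity
      simp only at h1 h2 h3
      exact ⟨⟨h1.1, h1.2.trans h4⟩, ⟨by linarith [h2.1], h2.2⟩, h3.1, by linarith [h3.2]⟩

theorem hasCover_surfaceS {α β : ℝ} (hα : 1 ≤ α) (hβ : 0 ≤ β) {δ : ℝ} (hδ : 0 < δ) (N : ℕ) :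
    HasCover (surfaceS α β) δ (6 * gridCount 1 δ ^ 2 +
      (∑ n ∈ Finset.Icc 1 N, 2 ^ ⌊(n : ℝ) * β⌋₊ * (6 * gridCount (2 * (1 / 2) ^ n) δ ^ 2) +
        gridCount ((1 / 2) ^ N) δ ^ 3)) := by
  refine HasCover.mono (HasCover.union ?_ (HasCover.union (HasCover.biUnion fun n hn => ?_) ?_))
    (surfaceS_subset hα hβ N) le_rfl
  · exact hasCover_box3_diff_interior hδ (by norm_num) (by norm_num) (by norm_num)
  · have : HasCover (⋃ j ∈ Finset.Icc 1 (2 ^ ⌊(n : ℝ) * β⌋₊),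
        (thinBox α β n j \ interior (thinBox α β n j))) δ
        (∑ j ∈ Finset.Icc 1 (2 ^ ⌊(n : ℝ) * β⌋₊), 6 * gridCount (2 * (1 / 2) ^ n) δ ^ 2) := by
      refine HasCover.biUnion fun j _ => hasCover_box3_diff_interior hδ ?_ ?_ ?_
      · have := two_mul_thickness_le hα β n
        have := segLength_le β n
        have := thickness_pos α β n
        have : (0 : ℝ) < (1 / 2) ^ n := by positivity
        linarith
      · linarith
      · have : (0 : ℝ) < (1 / 2) ^ n := by positivity
        linarith
    refine this.mono le_rfl (le_of_eq ?_)
    simp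
  · exact hasCover_box3_cube hδ (by linarith) (by linarith) (by linarith)

theorem mem_surfaceS_of_rightEnd {α β : ℝ} (hα : 1 ≤ α) (hβ : 0 ≤ β) {i : ℕ × ℕ}
    (hi : IsBoxIndex β i) {x : E3} (h0 : x 0 = rightEnd β i.1 i.2)
    (h1 : -(2 * (1 / 2) ^ i.1) ≤ x 1 ∧ x 1 ≤ 0) (h2 : 0 ≤ x 2 ∧ x 2 ≤ (1 / 2) ^ i.1) :
    x ∈ surfaceS α β := by
  have hC := thickness_pos α β i.1
  have hxT : x ∈ solidT α β := by
    refine thinBox_subset_solidT α hi ⟨⟨?_, ?_⟩, h1, h2⟩ <;> linarith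
  rw [surfaceS, frontier_eq_closure_inter_closure]
  refine ⟨subset_closure hxT, ?_⟩
  -- Moving right leaves the box and, for steps below `C_n / 2`, stays clear of all others; moving
  -- up as well avoids the cube when `x 2 = 0`.
  let v : E3 := !₂[1, 0, 1]
  have hlim : Tendsto (fun ε : ℝ => x + ε • v) (𝓝[>] 0) (𝓝 x) := by
    have : Continuous fun ε : ℝ => x + ε • v := by fun_prop
    have h := this.tendsto 0
    rw [zero_smul, add_zero] at h
    exact h.mono_left nhdsWithin_le_nhds
  refine mem_closure_of_tendsto hlim ?_
  filter_upwards [Ioo_mem_nhdsGT (half_pos hC)] with ε hε hmem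
  have e0 : (x + ε • v) 0 = x 0 + ε := by simp [v]
  have e2 : (x + ε • v) 2 = x 2 + ε := by simp [v]
  rcases mem_solidT.1 hmem with h | ⟨k, hk, h⟩
  · have := h.2.2.2
    rw [e2] at this
    linarith [hε.1]
  · have h3 := (mem_thinBox.1 h).1
    rw [e0] at h3
    have h4 : x 0 + ε - boxCenter α β i = thickness α β i.1 / 2 + ε := by
      rw [boxCenter, h0]; ring
    by_cases hik : i = k
    · subst hik
      rw [h4] at h3
      linarith [le_abs_self (thickness α β i.1 / 2 + ε), hε.1]
    · have h5 := thickness_add_le hα hβ hi hk hik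
      have h6 := abs_sub (x 0 + ε - boxCenter α β k) (x 0 + ε - boxCenter α β i)
      rw [show x 0 + ε - boxCenter α β k - (x 0 + ε - boxCenter α β i) =
        boxCenter α β i - boxCenter α β k by ring, h4,
        abs_of_pos (by linarith [hε.1] : 0 < thickness α β i.1 / 2 + ε)] at h6
      have := thickness_pos α β k.1
      linarith [hε.2]

theorem le_minCoverCard_surfaceS {α β : ℝ} (hα : 1 ≤ α) (hβ : 1 ≤ β) {n : ℕ} (hn : 1 ≤ n) :
    (2 ^ (⌊(n : ℝ) * β⌋₊ - 1)) ^ 3 ≤ minCoverCard (surfaceS α β) (segLength β n) := by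
  set M := 2 ^ (⌊(n : ℝ) * β⌋₊ - 1) with hM
  have hβ0 : 0 ≤ β := by linarith
  have hs := segLength_pos β n
  have hfl : 1 ≤ ⌊(n : ℝ) * β⌋₊ := by
    rw [Nat.one_le_floor_iff]
    have : (1 : ℝ) ≤ n := by exact_mod_cast hn
    nlinarith
  have h2M : 2 * M = 2 ^ ⌊(n : ℝ) * β⌋₊ := by
    rw [hM, ← pow_succ']
    congr 1; omega
  have h2Mr : segLength β n * (2 * (M : ℝ)) = (1 / 2) ^ n := by
    rw [← segLength_mul β n]
    congr 1
    exact_mod_cast h2M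
  -- A cubic grid of mesh `2 a_n` on the right faces of every other box; the doubled mesh makes the
  -- separation strictly larger than `a_n`.
  let P : Fin M × Fin M × Fin M → E3 := fun q =>
    !₂[rightEnd β n (2 * (q.1 : ℕ) + 1), -(2 * ((q.2.1 : ℕ) : ℝ) * segLength β n),
      2 * ((q.2.2 : ℕ) : ℝ) * segLength β n]
  have P0 : ∀ q, P q 0 = rightEnd β n (2 * (q.1 : ℕ) + 1) := fun q => rfl
  have P1 : ∀ q, P q 1 = -(2 * ((q.2.1 : ℕ) : ℝ) * segLength β n) := fun q => rfl
  have P2 : ∀ q, P q 2 = 2 * ((q.2.2 : ℕ) : ℝ) * segLength β n := fun q => rfl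
  have hlt : ∀ q : Fin M, 2 * ((q : ℕ) : ℝ) * segLength β n ≤ (1 / 2) ^ n := by
    intro q
    have : ((q : ℕ) : ℝ) ≤ M := by exact_mod_cast q.2.le
    rw [← h2Mr]
    nlinarith
  have hPS : ∀ q, P q ∈ surfaceS α β := by
    intro q
    have hidx : IsBoxIndex β (n, 2 * (q.1 : ℕ) + 1) := by
      refine ⟨hn, by simp, ?_⟩
      have := q.1.2
      simp only
      omega
    have hpos : (0 : ℝ) < (1 / 2) ^ n := by positivity
    refine mem_surfaceS_of_rightEnd hα hβ0 hidx (P0 q) ?_ ?_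
    · rw [P1]
      have := hlt q.2.1
      have : 0 ≤ 2 * ((q.2.1 : ℕ) : ℝ) * segLength β n := by positivity
      constructor <;> simp only <;> linarith
    · rw [P2]
      exact ⟨by positivity, hlt q.2.2⟩
  have hdiff : ∀ p q : Fin M, p ≠ q →
      segLength β n < |2 * ((p : ℕ) : ℝ) * segLength β n - 2 * ((q : ℕ) : ℝ) * segLength β n| := by
    intro p q hpq
    have h1 : ((p : ℕ) : ℤ) - (q : ℕ) ≠ 0 := by
      intro h
      apply hpq
      ext
      omega
    have h2 : (1 : ℝ) ≤ |((p : ℕ) : ℝ) - ((q : ℕ) : ℝ)| := by exact_mod_cast Int.one_le_abs h1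
    rw [show 2 * ((p : ℕ) : ℝ) * segLength β n - 2 * ((q : ℕ) : ℝ) * segLength β n =
      (2 * segLength β n) * (((p : ℕ) : ℝ) - ((q : ℕ) : ℝ)) by ring, abs_mul,
      abs_of_pos (by positivity)]
    nlinarith
  have := (hasCover_surfaceS hα hβ0 hs 0).card_le_minCoverCard hs.le hPS ?_
  · simp only [Fintype.card_prod, Fintype.card_fin] at this
    calc M ^ 3 = M * (M * M) := by ring
      _ ≤ _ := this
  · intro p q hpq
    by_cases h1 : p.1 = q.1
    · by_cases h2 : p.2.1 = q.2.1
      · have h3 : p.2.2 ≠ q.2.2 := fun h3 => hpq (Prod.ext h1 (Prod.ext h2 h3))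
        refine (hdiff _ _ h3).trans_le ?_
        rw [← P2, ← P2]
        exact abs_coord_sub_le_dist _ _ _
      · refine (hdiff _ _ h2).trans_le ?_
        have := abs_coord_sub_le_dist (P p) (P q) 1
        rwa [P1, P1, neg_sub_neg, abs_sub_comm] at this
    · refine (hdiff _ _ h1).trans_le ?_
      have := abs_coord_sub_le_dist (P p) (P q) 0
      rw [P0, P0, abs_sub_comm] at this
      refine le_trans (le_of_eq ?_) this
      congr 1
      simp only [rightEnd]
      push_cast
      ring

end

noncomputable section

/-! ### The upper Minkowski dimension -/

theorem minCoverCard_surfaceS_le {α β : ℝ} (hα : 1 ≤ α) (hβ : 2 ≤ β) {δ : ℝ} (hδ : 0 < δ)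
    (hδ1 : δ < 1) : (minCoverCard (surfaceS α β) δ : ℝ) ≤
      270 * (-Real.log δ + 1) * δ ^ (-(3 * β / (β + 1))) := by
  set L := -Real.log δ with hL
  have hLpos : 0 < L := by
    have := Real.log_neg hδ hδ1
    linarith
  have hlog2 := Real.log_two_gt_d9
  have hl2 : 0 < Real.log 2 := by linarith
  have hβ1 : 0 < β + 1 := by linarith
  -- `N` is the largest integer with `2 ^ (-N (β + 1)) ≥ δ`, which balances the faces of generation
  -- `N` against the cube holding the later boxes.
  set N := ⌊L / ((β + 1) * Real.log 2)⌋₊ with hN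
  have hden : 0 < (β + 1) * Real.log 2 := by positivity
  have hN1 : (N : ℝ) * ((β + 1) * Real.log 2) ≤ L :=
    (le_div_iff₀ hden).1 (Nat.floor_le (by positivity))
  have hN2 : L ≤ (N + 1) * ((β + 1) * Real.log 2) :=
    (div_le_iff₀ hden).1 (Nat.lt_floor_add_one _).le
  have hNL : (N : ℝ) ≤ L := by
    have : (1 : ℝ) ≤ (β + 1) * Real.log 2 := by nlinarith
    have h0 : (0 : ℝ) ≤ N := by positivity
    nlinarith
  have hδexp : ∀ t : ℝ, δ ^ t = Real.exp (-L * t) := by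
    intro t
    rw [Real.rpow_def_of_pos hδ, hL, neg_neg]
  have h2exp : ∀ n : ℕ, ((1 : ℝ) / 2) ^ n = Real.exp (-(n * Real.log 2)) := by
    intro n
    rw [Real.exp_neg, ← Real.log_pow, Real.exp_log (by positivity), one_div, inv_pow]
  have hδe : δ = Real.exp (-L) := by
    have := hδexp 1
    rwa [Real.rpow_one, mul_one] at this
  set D := δ ^ (-(3 * β / (β + 1))) with hD
  have hDpos : 0 < D := Real.rpow_pos_of_pos hδ _
  have hDe : D = Real.exp (L * (3 * β / (β + 1))) := by
    rw [hD, hδexp]; congr 1; ring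
  have hs2 : 2 ≤ 3 * β / (β + 1) := by rw [le_div_iff₀ hβ1]; linarith
  have hu : δ ≤ (1 / 2) ^ N := by
    rw [hδe, h2exp, Real.exp_le_exp]
    have h0 : (0 : ℝ) ≤ N := by positivity
    have : (N : ℝ) * Real.log 2 ≤ N * ((β + 1) * Real.log 2) := by
      apply mul_le_mul_of_nonneg_left _ h0
      nlinarith
    linarith
  have hun : ∀ n, n ≤ N → δ ≤ (1 / 2) ^ n := fun n hn =>
    hu.trans (pow_le_pow_of_le_one (by norm_num) (by norm_num) hn)
  have t1 : (1 / δ) ^ 2 ≤ D := by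
    rw [hδe, one_div, ← Real.exp_neg, ← Real.exp_nat_mul, hDe, Real.exp_le_exp]
    push_cast
    nlinarith
  have t2 : ∀ n ∈ Finset.Icc 1 N, (2 : ℝ) ^ ⌊(n : ℝ) * β⌋₊ * ((1 / 2) ^ n / δ) ^ 2 ≤ D := by
    intro n hn
    have hnN : (n : ℝ) ≤ N := by exact_mod_cast (Finset.mem_Icc.1 hn).2
    have hfl : (⌊(n : ℝ) * β⌋₊ : ℝ) ≤ n * β := Nat.floor_le (by positivity)
    have e2 : (2 : ℝ) ^ ⌊(n : ℝ) * β⌋₊ = Real.exp (⌊(n : ℝ) * β⌋₊ * Real.log 2) := by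
      rw [← Real.log_pow, Real.exp_log (by positivity)]
    rw [e2, h2exp, hδe, ← Real.exp_sub, ← Real.exp_nat_mul, ← Real.exp_add, hDe, Real.exp_le_exp]
    push_cast
    have e3 : L * (3 * β / (β + 1)) = 2 * L + (β - 2) * (L / (β + 1)) := by
      field_simp; ring
    have e4 : N * Real.log 2 ≤ L / (β + 1) := by
      rw [le_div_iff₀ hβ1]; linarith
    have e5 : n * Real.log 2 ≤ L / (β + 1) :=
      (mul_le_mul_of_nonneg_right hnN hl2.le).trans e4
    have e6 := mul_le_mul_of_nonneg_right hfl hl2.le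
    have e7 := mul_le_mul_of_nonneg_left e5 (by linarith : 0 ≤ β - 2)
    rw [e3]
    linarith
  have t3 : ((1 / 2) ^ N / δ) ^ 3 ≤ 8 * D := by
    have e8 : (8 : ℝ) = Real.exp (3 * Real.log 2) := by
      rw [show (3 : ℝ) * Real.log 2 = ((3 : ℕ) : ℝ) * Real.log 2 by norm_num, ← Real.log_pow,
        Real.exp_log (by positivity)]
      norm_num
    rw [h2exp, hδe, ← Real.exp_sub, ← Real.exp_nat_mul, hDe, e8, ← Real.exp_add, Real.exp_le_exp]
    push_cast
    have e3 : L * (3 * β / (β + 1)) = 3 * L - 3 * (L / (β + 1)) := by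
      field_simp; ring
    have e4 : L / (β + 1) ≤ (N + 1) * Real.log 2 := by
      rw [div_le_iff₀ hβ1]; linarith
    rw [e3]
    linarith
  have hg : ∀ l : ℝ, δ ≤ l → (gridCount l δ : ℝ) ^ 2 ≤ 9 * (l / δ) ^ 2 := by
    intro l hl
    have := pow_le_pow_left₀ (Nat.cast_nonneg _) (gridCount_le hδ hl) 2
    nlinarith
  have b1 : (gridCount 1 δ : ℝ) ^ 2 ≤ 9 * D := by
    have := hg 1 hδ1.le
    linarith
  have b2 : ∀ n ∈ Finset.Icc 1 N,
      (2 : ℝ) ^ ⌊(n : ℝ) * β⌋₊ * (6 * (gridCount (2 * (1 / 2) ^ n) δ : ℝ) ^ 2) ≤ 216 * D := by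
    intro n hn
    have h1 := hun n (Finset.mem_Icc.1 hn).2
    have h2 : (0 : ℝ) < (1 / 2) ^ n := by positivity
    have h3 := hg (2 * (1 / 2) ^ n) (by linarith)
    have h4 : (2 * (1 / 2) ^ n / δ) ^ 2 = 4 * ((1 / 2) ^ n / δ) ^ 2 := by ring
    rw [h4] at h3
    have h5 : (0 : ℝ) < 2 ^ ⌊(n : ℝ) * β⌋₊ := by positivity
    have h6 := mul_le_mul_of_nonneg_left h3 h5.le
    have h7 := t2 n hn
    linarith
  have b3 : (gridCount ((1 / 2) ^ N) δ : ℝ) ^ 3 ≤ 216 * D := by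
    have := pow_le_pow_left₀ (Nat.cast_nonneg _) (gridCount_le hδ hu) 3
    rw [mul_pow] at this
    linarith
  -- The constant is `270 = 54 + 216`, from the unit cube and the tail; each of the `N ≤ -log δ`
  -- generations adds another `216`.
  have hcov := (hasCover_surfaceS (β := β) hα (by linarith) hδ N).minCoverCard_le
  have hcov' : (minCoverCard (surfaceS α β) δ : ℝ) ≤ 6 * (gridCount 1 δ : ℝ) ^ 2 +
      (∑ n ∈ Finset.Icc 1 N, (2 : ℝ) ^ ⌊(n : ℝ) * β⌋₊ *
        (6 * (gridCount (2 * (1 / 2) ^ n) δ : ℝ) ^ 2) + (gridCount ((1 / 2) ^ N) δ : ℝ) ^ 3) := by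
    exact_mod_cast hcov
  have hsum := Finset.sum_le_sum b2
  rw [Finset.sum_const, Nat.card_Icc, Nat.add_sub_cancel, nsmul_eq_mul] at hsum
  have hND : (N : ℝ) * D ≤ L * D := mul_le_mul_of_nonneg_right hNL hDpos.le
  have hLD : 0 < L * D := by positivity
  nlinarith

theorem upperMinkowskiDim_surfaceS_le {α β : ℝ} (hα : 1 ≤ α) (hβ : 2 ≤ β) :
    upperMinkowskiDim (surfaceS α β) ≤ ((3 * β / (β + 1) : ℝ) : EReal) := by
  by_contra! hlt
  obtain ⟨c, hc1, hc2⟩ := EReal.lt_iff_exists_real_btwn.1 hlt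
  rw [EReal.coe_lt_coe_iff] at hc1
  refine not_le.2 hc2 (limsup_le_of_le (by isBoundedDefault) ?_)
  set s := 3 * β / (β + 1) with hs
  -- For `-log δ ≥ 1` the prefactor `270 (-log δ + 1)` is at most `540 (-log δ)`, so its logarithm
  -- is absorbed by `(c - s) (-log δ)`.
  have hε : 0 < (c - s) / 540 := by linarith
  have hlogL : Tendsto (fun δ : ℝ => -Real.log δ) (𝓝[>] 0) atTop :=
    tendsto_neg_atBot_atTop.comp Real.tendsto_log_nhdsGT_zero
  have hy : Tendsto (fun δ : ℝ => 270 * (-Real.log δ + 1)) (𝓝[>] 0) atTop :=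
    (tendsto_atTop_add_const_right _ _ hlogL).const_mul_atTop (by norm_num)
  have hlo := hy.eventually (Real.isLittleO_log_id_atTop.bound hε)
  filter_upwards [hlo, hlogL.eventually_ge_atTop 1, Ioo_mem_nhdsGT (zero_lt_one' ℝ)] with δ h1 h2 h3
  rw [EReal.coe_le_coe_iff]
  have hLpos : 0 < -Real.log δ := by linarith
  rw [div_le_iff₀ hLpos]
  have hypos : 0 < 270 * (-Real.log δ + 1) := by linarith
  have h4 : Real.log (270 * (-Real.log δ + 1)) ≤ (c - s) / 540 * (270 * (-Real.log δ + 1)) := by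
    have := (le_abs_self _).trans h1
    rwa [id, Real.norm_of_nonneg hypos.le] at this
  have h5 : Real.log (270 * (-Real.log δ + 1)) ≤ (c - s) * (-Real.log δ) := by
    refine h4.trans ?_
    nlinarith
  have hspos : 0 ≤ s := by rw [hs]; positivity
  rcases Nat.eq_zero_or_pos (minCoverCard (surfaceS α β) δ) with h0 | h0
  · rw [h0, Nat.cast_zero, Real.log_zero]
    have : 0 ≤ c := by linarith
    positivity
  · have h6 := Real.log_le_log (by exact_mod_cast h0) (minCoverCard_surfaceS_le hα hβ h3.1 h3.2)
    rw [Real.log_mul hypos.ne' (Real.rpow_pos_of_pos h3.1 _).ne', Real.log_rpow h3.1, ← hs] at h6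
    linarith

theorem tendsto_segLength {β : ℝ} : Tendsto (segLength β) atTop (𝓝[>] 0) := by
  rw [tendsto_nhdsWithin_iff]
  refine ⟨?_, Eventually.of_forall fun n => segLength_pos β n⟩
  refine squeeze_zero (fun n => (segLength_pos β n).le) (segLength_le β) ?_
  exact tendsto_pow_atTop_nhds_zero_of_lt_one (by norm_num) (by norm_num)

theorem le_upperMinkowskiDim_surfaceS {α β : ℝ} (hα : 1 ≤ α) (hβ : 2 ≤ β) :
    ((3 * β / (β + 1) : ℝ) : EReal) ≤ upperMinkowskiDim (surfaceS α β) := by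
  by_contra! hlt
  obtain ⟨c, hc1, hc2⟩ := EReal.lt_iff_exists_real_btwn.1 hlt
  rw [EReal.coe_lt_coe_iff] at hc2
  refine not_le.2 hc1 (le_limsup_of_frequently_le (tendsto_segLength (β := β) |>.frequently ?_)
    (by isBoundedDefault))
  apply Eventually.frequently
  have hβ1 : 0 < β + 1 := by linarith
  have hl2 : 0 < Real.log 2 := Real.log_pos (by norm_num)
  -- The `6` collects two losses of at most `3` in the exponent: rounding `n β` down, and using only
  -- every other grid position in three directions.
  have hlim : Tendsto (fun n : ℕ => (6 : ℝ) / (n : ℝ)) atTop (𝓝 0) :=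
    tendsto_const_div_atTop_nhds_zero_nat 6
  have hε : 0 < (3 * β / (β + 1) - c) * (β + 1) := mul_pos (by linarith) hβ1
  filter_upwards [eventually_ge_atTop 1, hlim.eventually_lt_const hε] with n hn hn2
  rw [EReal.coe_le_coe_iff]
  have hnr : (1 : ℝ) ≤ n := by exact_mod_cast hn
  set m := ⌊(n : ℝ) * β⌋₊ with hm
  have hm1 : (m : ℝ) ≤ n * β := Nat.floor_le (by positivity)
  have hm2 : (n : ℝ) * β - 1 < m := by
    have := Nat.lt_floor_add_one ((n : ℝ) * β)
    linarith
  have hmge : 1 ≤ m := by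
    rw [hm, Nat.one_le_floor_iff]; nlinarith
  have hseg : -Real.log (segLength β n) = (n + m) * Real.log 2 := by
    unfold segLength
    rw [Real.log_pow, one_div, Real.log_inv, ← hm]
    push_cast
    ring
  have hpos : 0 < (n + m) * Real.log 2 := by positivity
  rw [hseg, le_div_iff₀ hpos]
  have hcard := le_minCoverCard_surfaceS (α := α) (β := β) hα (by linarith) hn
  have hcard' : ((2 : ℝ) ^ (m - 1)) ^ 3 ≤ minCoverCard (surfaceS α β) (segLength β n) := by
    exact_mod_cast hcard
  have hlog := Real.log_le_log (by positivity) hcard'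
  rw [Real.log_pow, Real.log_pow, Nat.cast_sub hmge] at hlog
  refine le_trans ?_ hlog
  push_cast
  have k1 : 6 < (3 * β - c * (β + 1)) * n := by
    rw [div_lt_iff₀ (by linarith)] at hn2
    have : (3 * β / (β + 1) - c) * (β + 1) = 3 * β - c * (β + 1) := by field_simp
    rwa [this] at hn2
  have k2 : c * (n + m) ≤ 3 * (m - 1) := by
    have hc3 : c < 3 := by
      have : 3 * β / (β + 1) < 3 := by rw [div_lt_iff₀ hβ1]; linarith
      linarith
    rcases le_or_gt c 0 with h0 | h0
    · have : (1 : ℝ) ≤ m := by exact_mod_cast hmge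
      nlinarith
    · nlinarith
  nlinarith

theorem upperMinkowskiDim_surfaceS {α β : ℝ} (hα : 1 ≤ α) (hβ : 2 ≤ β) :
    upperMinkowskiDim (surfaceS α β) = ((3 * β / (β + 1) : ℝ) : EReal) :=
  le_antisymm (upperMinkowskiDim_surfaceS_le hα hβ) (le_upperMinkowskiDim_surfaceS hα hβ)

end

noncomputable section

/-! ### Integrals over boxes -/

theorem ennreal_rpow_neg_anti {a b : ENNReal} (h : a ≤ b) {p : ℝ} (hp : 0 ≤ p) :
    b ^ (-p) ≤ a ^ (-p) := by
  rw [ENNReal.rpow_neg, ENNReal.rpow_neg, ENNReal.inv_le_inv]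
  exact ENNReal.rpow_le_rpow h hp

theorem lintegral_Icc_rpow_neg {p : ℝ} (hp1 : p < 1) {L : ℝ} (hL : 0 ≤ L) :
    ∫⁻ t in Set.Icc 0 L, ENNReal.ofReal t ^ (-p) = ENNReal.ofReal (L ^ (1 - p) / (1 - p)) := by
  have h1 : ∫⁻ t in Set.Icc 0 L, ENNReal.ofReal t ^ (-p) =
      ∫⁻ t in Set.Ioc 0 L, ENNReal.ofReal (t ^ (-p)) := by
    rw [← restrict_Ioc_eq_restrict_Icc]
    refine setLIntegral_congr_fun measurableSet_Ioc fun t ht => ?_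
    exact ENNReal.ofReal_rpow_of_pos ht.1
  have hint := intervalIntegral.intervalIntegrable_rpow' (a := 0) (b := L)
    (by linarith : -1 < -p)
  rw [intervalIntegrable_iff_integrableOn_Ioc_of_le hL] at hint
  rw [h1, ← ofReal_integral_eq_lintegral_ofReal hint, ← intervalIntegral.integral_of_le hL,
    integral_rpow (Or.inl (by linarith))]
  · rw [Real.zero_rpow (by linarith), sub_zero]
    congr 2 <;> ring_nf
  · filter_upwards [ae_restrict_mem measurableSet_Ioc] with t ht
    exact Real.rpow_nonneg ht.1.le _

theorem lintegral_Icc_sub_left_rpow_neg {p : ℝ} (hp1 : p < 1) {a b : ℝ} (hab : a ≤ b) :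
    ∫⁻ t in Set.Icc a b, ENNReal.ofReal (t - a) ^ (-p) =
      ENNReal.ofReal ((b - a) ^ (1 - p) / (1 - p)) := by
  have h := (measurePreserving_sub_right volume a).setLIntegral_comp_preimage
    (measurableSet_Icc (a := 0) (b := b - a)) (f := fun t => ENNReal.ofReal t ^ (-p)) (by fun_prop)
  rw [lintegral_Icc_rpow_neg hp1 (by linarith : 0 ≤ b - a)] at h
  rw [← h]
  congr 2
  ext t
  simp

theorem lintegral_Icc_sub_right_rpow_neg {p : ℝ} (hp1 : p < 1) {a b : ℝ} (hab : a ≤ b) :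
    ∫⁻ t in Set.Icc a b, ENNReal.ofReal (b - t) ^ (-p) =
      ENNReal.ofReal ((b - a) ^ (1 - p) / (1 - p)) := by
  have h := (Measure.measurePreserving_sub_left volume b).setLIntegral_comp_preimage
    (measurableSet_Icc (a := 0) (b := b - a)) (f := fun t => ENNReal.ofReal t ^ (-p)) (by fun_prop)
  rw [lintegral_Icc_rpow_neg hp1 (by linarith : 0 ≤ b - a)] at h
  rw [← h]
  congr 2
  ext t
  simp

theorem volume_coord_pi (s : Fin 3 → Set ℝ) (hs : ∀ i, MeasurableSet (s i)) :
    volume {x : E3 | ∀ i, x i ∈ s i} = ∏ i, volume (s i) := by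
  rw [← volume_pi_pi, ← (PiLp.volume_preserving_ofLp (Fin 3)).measure_preimage
    (MeasurableSet.univ_pi hs).nullMeasurableSet]
  congr 1
  ext x
  simp

theorem setLIntegral_coord (lo hi : Fin 3 → ℝ) (i : Fin 3) {F : ℝ → ENNReal} (hF : Measurable F) :
    ∫⁻ x in {x : E3 | ∀ j, x j ∈ Set.Icc (lo j) (hi j)}, F (x i) =
      (∏ j ∈ Finset.univ.erase i, ENNReal.ofReal (hi j - lo j)) *
        ∫⁻ t in Set.Icc (lo i) (hi i), F t := by
  have hpre : {x : E3 | ∀ j, x j ∈ Set.Icc (lo j) (hi j)} =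
      WithLp.ofLp ⁻¹' (Set.univ.pi fun j => Set.Icc (lo j) (hi j)) := by
    ext x
    simp [Pi.le_def, forall_and]
  have hm : MeasurableSet (Set.univ.pi fun j => Set.Icc (lo j) (hi j)) :=
    MeasurableSet.univ_pi fun j => measurableSet_Icc
  rw [hpre]
  have h1 := (PiLp.volume_preserving_ofLp (Fin 3)).setLIntegral_comp_preimage hm
    (f := fun v : Fin 3 → ℝ => F (v i)) (hF.comp (measurable_pi_apply i))
  refine h1.trans ?_
  rw [volume_pi, Measure.restrict_pi_pi]
  have h2 := lintegral_map (μ := Measure.pi fun j : Fin 3 => volume.restrict (Set.Icc (lo j) (hi j)))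
    hF (measurable_pi_apply i)
  refine h2.symm.trans ?_
  have h3 := Measure.pi_map_eval (fun j : Fin 3 => volume.restrict (Set.Icc (lo j) (hi j))) i
  unfold Function.eval at h3
  rw [h3, lintegral_smul_measure]
  simp

/-- The integral of the power `-p` of the distance to a set that avoids the interior of a box,
taken over this box. -/
theorem setLIntegral_infEDist_rpow_le {p : ℝ} (hp0 : 0 ≤ p) (hp1 : p < 1) {lo hi : Fin 3 → ℝ}
    {l : ℝ} (hl : 0 < l) (hlen : ∀ i, l ≤ hi i - lo i) {S : Set E3}
    (hS : ∀ x ∈ S, ∃ i, x i ∉ Set.Ioo (lo i) (hi i)) :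
    ∫⁻ x in {x : E3 | ∀ j, x j ∈ Set.Icc (lo j) (hi j)}, Metric.infEDist x S ^ (-p) ≤
      ENNReal.ofReal (6 * (∏ i, (hi i - lo i)) * l ^ (-p) / (1 - p)) := by
  have hm : ∀ i, Measurable fun t : ℝ =>
      ENNReal.ofReal (t - lo i) ^ (-p) + ENNReal.ofReal (hi i - t) ^ (-p) := fun i => by fun_prop
  have hmeas : MeasurableSet {x : E3 | ∀ j, x j ∈ Set.Icc (lo j) (hi j)} := by
    have : {x : E3 | ∀ j, x j ∈ Set.Icc (lo j) (hi j)} =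
        ⋂ j, (fun x : E3 => x j) ⁻¹' Set.Icc (lo j) (hi j) := by
      ext x; simp
    rw [this]
    exact MeasurableSet.iInter fun j => measurableSet_Icc.preimage (by fun_prop)
  have hpt : ∀ x ∈ {x : E3 | ∀ j, x j ∈ Set.Icc (lo j) (hi j)}, Metric.infEDist x S ^ (-p) ≤
      ∑ i, (ENNReal.ofReal (x i - lo i) ^ (-p) + ENNReal.ofReal (hi i - x i) ^ (-p)) := by
    intro x hx
    obtain ⟨i, -, hi_min⟩ := Finset.exists_min_image (Finset.univ : Finset (Fin 3))
      (fun i => min (x i - lo i) (hi i - x i)) Finset.univ_nonempty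
    -- Points of `S` lie outside the open box, so they are no closer to `x` than its nearest face;
    -- replacing the minimum by a sum over faces reduces the integral to one-dimensional ones.
    have hd : ENNReal.ofReal (min (x i - lo i) (hi i - x i)) ≤ Metric.infEDist x S := by
      rw [Metric.le_infEDist]
      intro y hy
      obtain ⟨k, hk⟩ := hS y hy
      rw [edist_dist]
      apply ENNReal.ofReal_le_ofReal
      refine (hi_min k (Finset.mem_univ k)).trans (le_trans ?_ (abs_coord_sub_le_dist x y k))
      rw [Set.mem_Ioo, not_and_or, not_lt, not_lt] at hk
      rcases hk with hk | hk
      · exact (min_le_left _ _).trans ((by linarith : x k - lo k ≤ x k - y k).trans (le_abs_self _))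
      · refine (min_le_right _ _).trans ((by linarith : hi k - x k ≤ -(x k - y k)).trans
          (neg_le_abs _))
    refine (ennreal_rpow_neg_anti hd hp0).trans ?_
    refine le_trans ?_ (Finset.single_le_sum (f := fun i =>
      ENNReal.ofReal (x i - lo i) ^ (-p) + ENNReal.ofReal (hi i - x i) ^ (-p))
      (fun _ _ => zero_le) (Finset.mem_univ i))
    rcases min_choice (x i - lo i) (hi i - x i) with h | h
    · rw [h]; exact le_self_add
    · rw [h]; exact le_add_self
  refine (setLIntegral_mono' hmeas hpt).trans ?_
  have hmc : ∀ i ∈ (Finset.univ : Finset (Fin 3)), Measurable fun x : E3 =>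
      ENNReal.ofReal (x i - lo i) ^ (-p) + ENNReal.ofReal (hi i - x i) ^ (-p) :=
    fun i _ => (hm i).comp (by fun_prop : Measurable fun x : E3 => x i)
  rw [lintegral_finsetSum _ hmc]
  have hV : 0 ≤ ∏ i, (hi i - lo i) := Finset.prod_nonneg fun i _ => by linarith [hlen i]
  have hp' : 0 < 1 - p := by linarith
  have hterm : ∀ i ∈ (Finset.univ : Finset (Fin 3)),
      ∫⁻ x in {x : E3 | ∀ j, x j ∈ Set.Icc (lo j) (hi j)},
        (ENNReal.ofReal (x i - lo i) ^ (-p) + ENNReal.ofReal (hi i - x i) ^ (-p)) ≤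
      ENNReal.ofReal (2 * (∏ i, (hi i - lo i)) * l ^ (-p) / (1 - p)) := by
    intro i _
    have hLi : 0 < hi i - lo i := by linarith [hlen i]
    rw [setLIntegral_coord lo hi i (hm i), lintegral_add_left (by fun_prop),
      lintegral_Icc_sub_left_rpow_neg hp1 (by linarith),
      lintegral_Icc_sub_right_rpow_neg hp1 (by linarith),
      ← ENNReal.ofReal_add (by positivity) (by positivity),
      ← ENNReal.ofReal_prod_of_nonneg (fun j _ => by linarith [hlen j]),
      ← ENNReal.ofReal_mul (Finset.prod_nonneg fun j _ => by linarith [hlen j])]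
    apply ENNReal.ofReal_le_ofReal
    rw [← Finset.mul_prod_erase Finset.univ _ (Finset.mem_univ i)]
    have e1 : (hi i - lo i) ^ (1 - p) = (hi i - lo i) * (hi i - lo i) ^ (-p) := by
      rw [sub_eq_add_neg 1 p, Real.rpow_add hLi, Real.rpow_one]
    have e2 : (hi i - lo i) ^ (-p) ≤ l ^ (-p) :=
      Real.rpow_le_rpow_of_nonpos hl (hlen i) (by linarith)
    have e3 : 0 ≤ ∏ j ∈ Finset.univ.erase i, (hi j - lo j) :=
      Finset.prod_nonneg fun j _ => by linarith [hlen j]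
    rw [e1]
    calc (∏ j ∈ Finset.univ.erase i, (hi j - lo j)) *
          ((hi i - lo i) * (hi i - lo i) ^ (-p) / (1 - p) +
            (hi i - lo i) * (hi i - lo i) ^ (-p) / (1 - p))
        = 2 * ((hi i - lo i) * ∏ j ∈ Finset.univ.erase i, (hi j - lo j)) *
          (hi i - lo i) ^ (-p) / (1 - p) := by ring
      _ ≤ _ := by gcongr
  refine (Finset.sum_le_sum hterm).trans ?_
  rw [Finset.sum_const, Finset.card_univ, Fintype.card_fin, nsmul_eq_mul,
    ← ENNReal.ofReal_natCast, ← ENNReal.ofReal_mul (by positivity)]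
  apply ENNReal.ofReal_le_ofReal
  push_cast
  apply le_of_eq
  ring

theorem setLIntegral_box3_infEDist_rpow_le {p : ℝ} (hp0 : 0 ≤ p) (hp1 : p < 1) {a b c d e f : ℝ}
    {l : ℝ} (hl : 0 < l) (h0 : l ≤ b - a) (h1 : l ≤ d - c) (h2 : l ≤ f - e) {S : Set E3}
    (hS : Disjoint S (interior (box3 a b c d e f))) :
    ∫⁻ x in box3 a b c d e f, Metric.infEDist x S ^ (-p) ≤
      ENNReal.ofReal (6 * ((b - a) * (d - c) * (f - e)) * l ^ (-p) / (1 - p)) := by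
  have hbox : box3 a b c d e f =
      {x : E3 | ∀ j, x j ∈ Set.Icc ((![a, c, e] : Fin 3 → ℝ) j) ((![b, d, f] : Fin 3 → ℝ) j)} := by
    ext x
    simp [box3, Fin.forall_fin_succ]
  have := setLIntegral_infEDist_rpow_le hp0 hp1 (lo := ![a, c, e]) (hi := ![b, d, f]) hl
    (by simp [Fin.forall_fin_succ, h0, h1, h2]) (S := S) (by
      intro x hx
      by_contra! hcon
      exact Set.disjoint_left.1 hS hx (mem_interior_box3 (hcon 0) (hcon 1) (hcon 2)))
  rw [← hbox, Fin.prod_univ_three] at this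
  exact this

end

noncomputable section

/-! ### The inner Marcinkiewicz exponent -/

/-- The order of magnitude of the integral of the power `q - 1` of the distance over the boxes
of generation `n`. -/
def genWeight (α β q : ℝ) (n : ℕ) : ℝ :=
  2 ^ ⌊(n : ℝ) * β⌋₊ * thickness α β n ^ q * ((1 / 2) ^ n * (1 / 2) ^ n)

/-- Isolates the rounding error of `⌊n β⌋`: it changes the exponent by a bounded amount, so the
weights lie between constant multiples of one geometric sequence. -/
theorem genWeight_eq_exp (α β q : ℝ) (n : ℕ) : genWeight α β q n =
    Real.exp (Real.log 2 * (n * (β - 2 - α * q * (β + 1)) - q +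
      (1 - α * q) * ((⌊(n : ℝ) * β⌋₊ : ℝ) - n * β))) := by
  have h2 : ∀ m : ℕ, (2 : ℝ) ^ m = Real.exp (m * Real.log 2) := fun m => by
    rw [← Real.log_pow, Real.exp_log (by positivity)]
  have h2' : ∀ m : ℕ, ((1 : ℝ) / 2) ^ m = Real.exp (-(m * Real.log 2)) := fun m => by
    rw [Real.exp_neg, ← h2, one_div, inv_pow]
  have hC : thickness α β n =
      Real.exp (-(1 + α * (n + (⌊(n : ℝ) * β⌋₊ : ℝ))) * Real.log 2) := by
    have h1 := h2' 1
    rw [pow_one] at h1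
    rw [thickness, segLength, h2', ← Real.exp_mul, h1, ← Real.exp_add]
    push_cast
    ring_nf
  rw [genWeight, hC, h2, h2', ← Real.exp_mul, ← Real.exp_add, ← Real.exp_add, ← Real.exp_add]
  ring_nf

theorem abs_floor_error_le {α β q : ℝ} (hβ : 0 ≤ β) (n : ℕ) :
    |(1 - α * q) * ((⌊(n : ℝ) * β⌋₊ : ℝ) - n * β)| ≤ |1 - α * q| := by
  rw [abs_mul]
  apply mul_le_of_le_one_right (abs_nonneg _)
  have h1 : (⌊(n : ℝ) * β⌋₊ : ℝ) ≤ n * β := Nat.floor_le (by positivity)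
  have h2 := Nat.lt_floor_add_one ((n : ℝ) * β)
  rw [abs_le]
  constructor <;> linarith

theorem genWeight_le {β : ℝ} (α q : ℝ) (hβ : 0 ≤ β) (n : ℕ) :
    genWeight α β q n ≤ Real.exp (Real.log 2 * (|1 - α * q| - q)) *
      Real.exp (Real.log 2 * (β - 2 - α * q * (β + 1))) ^ n := by
  have hl2 : 0 < Real.log 2 := Real.log_pos (by norm_num)
  rw [genWeight_eq_exp, ← Real.exp_nat_mul, ← Real.exp_add, Real.exp_le_exp]
  have := mul_le_mul_of_nonneg_left
    ((le_abs_self _).trans (abs_floor_error_le (α := α) (q := q) hβ n)) hl2.le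
  linarith

theorem le_genWeight {β : ℝ} (α q : ℝ) (hβ : 0 ≤ β) (n : ℕ) :
    Real.exp (Real.log 2 * (-|1 - α * q| - q)) *
      Real.exp (Real.log 2 * (β - 2 - α * q * (β + 1))) ^ n ≤ genWeight α β q n := by
  have hl2 : 0 < Real.log 2 := Real.log_pos (by norm_num)
  rw [genWeight_eq_exp, ← Real.exp_nat_mul, ← Real.exp_add, Real.exp_le_exp]
  have := mul_le_mul_of_nonneg_left
    ((neg_le_neg (abs_floor_error_le (α := α) (q := q) hβ n)).trans (neg_abs_le _)) hl2.le
  linarith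

theorem summable_genWeight {α β q : ℝ} (hβ : 0 ≤ β) (h : β - 2 < α * q * (β + 1)) :
    Summable fun n => genWeight α β q (n + 1) := by
  have hl2 : 0 < Real.log 2 := Real.log_pos (by norm_num)
  have hlt : Real.exp (Real.log 2 * (β - 2 - α * q * (β + 1))) < 1 := by
    rw [Real.exp_lt_one_iff]
    nlinarith
  have hs : Summable (genWeight α β q) := by
    refine Summable.of_nonneg_of_le (fun n => ?_) (genWeight_le α q hβ)
      ((summable_geometric_of_lt_one (Real.exp_pos _).le hlt).mul_left _)
    rw [genWeight_eq_exp]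
    exact (Real.exp_pos _).le
  exact (summable_nat_add_iff 1).2 hs

theorem tendsto_genWeight {α β q : ℝ} (hβ : 0 ≤ β) (h : α * q * (β + 1) < β - 2) :
    Tendsto (genWeight α β q) atTop atTop := by
  have hl2 : 0 < Real.log 2 := Real.log_pos (by norm_num)
  have hlt : 1 < Real.exp (Real.log 2 * (β - 2 - α * q * (β + 1))) := by
    rw [Real.one_lt_exp_iff]
    nlinarith
  exact tendsto_atTop_mono (le_genWeight α q hβ)
    ((tendsto_pow_atTop_atTop_of_one_lt hlt).const_mul_atTop (Real.exp_pos _))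

theorem solidT_subset_iUnion (α β : ℝ) : solidT α β ⊆ baseCube ∪
    ⋃ q : (Σ n : ℕ, Fin (2 ^ ⌊((n + 1 : ℕ) : ℝ) * β⌋₊)), thinBox α β (q.1 + 1) (q.2 + 1) := by
  intro x hx
  rcases mem_solidT.1 hx with h | ⟨⟨n, j⟩, ⟨h1, h2, h3⟩, h⟩
  · exact Or.inl h
  · right
    simp only at h1 h2 h3 h
    obtain ⟨n, rfl⟩ := Nat.exists_eq_add_of_le' h1
    obtain ⟨j, rfl⟩ := Nat.exists_eq_add_of_le' h2
    exact Set.mem_iUnion.2 ⟨⟨n, ⟨j, h3⟩⟩, h⟩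

theorem disjoint_surfaceS_interior {α β : ℝ} (hα : 1 ≤ α) (hβ : 0 ≤ β) {B : Set E3}
    (hB : B ⊆ solidT α β) : Disjoint (surfaceS α β) (interior B) := by
  rw [surfaceS_eq_diff hα hβ, Set.disjoint_left]
  exact fun x hx hx' => hx.2 (interior_mono hB hx')

theorem distIntegral_innerPart_lt_top {α β p : ℝ} (hα : 1 ≤ α) (hβ : 0 ≤ β) (hp0 : 0 ≤ p)
    (hp1 : p < 1) (h : β - 2 < α * (1 - p) * (β + 1)) :
    distIntegral (surfaceS α β) (innerPart (surfaceS α β)) p < ⊤ := by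
  rw [distIntegral, innerPart_surfaceS hα hβ]
  refine (lintegral_mono_set (interior_subset.trans (solidT_subset_iUnion α β))).trans_lt ?_
  refine (lintegral_union_le _ _ _).trans_lt (ENNReal.add_lt_top.2 ⟨?_, ?_⟩)
  · exact (setLIntegral_box3_infEDist_rpow_le hp0 hp1 one_pos (by norm_num) (by norm_num)
      (by norm_num) (disjoint_surfaceS_interior hα hβ (baseCube_subset α β))).trans_lt
      ENNReal.ofReal_lt_top
  · have hp' : 0 < 1 - p := by linarith
    refine (lintegral_iUnion_le _ _).trans_lt ?_
    have hbound : ∀ q : (Σ n : ℕ, Fin (2 ^ ⌊((n + 1 : ℕ) : ℝ) * β⌋₊)),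
        ∫⁻ x in thinBox α β (q.1 + 1) (q.2 + 1), Metric.infEDist x (surfaceS α β) ^ (-p) ≤
        ENNReal.ofReal (12 / (1 - p) * (thickness α β (q.1 + 1) ^ (1 - p) *
          ((1 / 2) ^ (q.1 + 1) * (1 / 2) ^ (q.1 + 1)))) := by
      rintro ⟨n, j, hj⟩
      have hidx : IsBoxIndex β (n + 1, j + 1) := ⟨by simp, by simp, hj⟩
      have hC := thickness_pos α β (n + 1)
      have h1 := two_mul_thickness_le hα β (n + 1)
      have h2 := segLength_le β (n + 1)
      have h3 : (0 : ℝ) < (1 / 2) ^ (n + 1) := by positivity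
      refine (setLIntegral_box3_infEDist_rpow_le hp0 hp1 hC (by linarith) (by linarith)
        (by linarith) (disjoint_surfaceS_interior hα hβ (thinBox_subset_solidT α hidx))).trans ?_
      apply ENNReal.ofReal_le_ofReal
      apply le_of_eq
      simp only
      rw [sub_eq_add_neg 1 p, Real.rpow_add hC, Real.rpow_one]
      ring
    refine (ENNReal.tsum_le_tsum hbound).trans_lt ?_
    rw [ENNReal.tsum_sigma fun (n : ℕ) (_ : Fin (2 ^ ⌊((n + 1 : ℕ) : ℝ) * β⌋₊)) =>
      ENNReal.ofReal (12 / (1 - p) * (thickness α β (n + 1) ^ (1 - p) *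
          ((1 / 2) ^ (n + 1) * (1 / 2) ^ (n + 1))))]
    have hsum := ((summable_genWeight (α := α) (q := 1 - p) hβ h).mul_left
      (12 / (1 - p))).tsum_ofReal_lt_top
    refine lt_of_le_of_lt (ENNReal.tsum_le_tsum fun n => ?_) hsum
    rw [tsum_fintype, Finset.sum_const, Finset.card_univ, Fintype.card_fin, nsmul_eq_mul,
      ← ENNReal.ofReal_natCast, ← ENNReal.ofReal_mul (by positivity)]
    apply ENNReal.ofReal_le_ofReal
    apply le_of_eq
    rw [genWeight]
    push_cast
    ring

/-- The interior of the box `R_{n j}`. -/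
def openThinBox (α β : ℝ) (n j : ℕ) : Set E3 :=
  {x | ∀ i, x i ∈ (![Set.Ioo (rightEnd β n j - thickness α β n) (rightEnd β n j),
    Set.Ioo (-(2 * (1 / 2) ^ n)) 0, Set.Ioo 0 ((1 / 2) ^ n)] : Fin 3 → Set ℝ) i}

theorem openThinBox_subset (α β : ℝ) (n j : ℕ) :
    openThinBox α β n j ⊆ interior (thinBox α β n j) := fun _ hx =>
  mem_interior_box3 (hx 0) (hx 1) (hx 2)

theorem measurableSet_openThinBox (α β : ℝ) (n j : ℕ) : MeasurableSet (openThinBox α β n j) := by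
  have : openThinBox α β n j = ⋂ i, (fun x : E3 => x i) ⁻¹'
      (![Set.Ioo (rightEnd β n j - thickness α β n) (rightEnd β n j),
    Set.Ioo (-(2 * (1 / 2) ^ n)) 0, Set.Ioo 0 ((1 / 2) ^ n)] : Fin 3 → Set ℝ) i := by
    ext x
    simp [openThinBox]
  rw [this]
  refine MeasurableSet.iInter fun i => MeasurableSet.preimage ?_ (by fun_prop)
  fin_cases i <;> exact measurableSet_Ioo

theorem volume_openThinBox (α β : ℝ) (n j : ℕ) : volume (openThinBox α β n j) =
    ENNReal.ofReal (2 * thickness α β n * ((1 / 2) ^ n * (1 / 2) ^ n)) := by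
  have hC := thickness_pos α β n
  rw [openThinBox, volume_coord_pi _ fun i => by fin_cases i <;> exact measurableSet_Ioo,
    Fin.prod_univ_three]
  simp only [Matrix.cons_val_zero, Matrix.cons_val_one, Matrix.cons_val, Real.volume_Ioo]
  rw [← ENNReal.ofReal_mul (by linarith), ← ENNReal.ofReal_mul (by
    rw [sub_sub_cancel, zero_sub, neg_neg]; positivity)]
  congr 1
  ring

theorem infEDist_le_of_mem_openThinBox {α β : ℝ} (hα : 1 ≤ α) (hβ : 0 ≤ β) {n j : ℕ}
    (hi : IsBoxIndex β (n, j)) {x : E3} (hx : x ∈ openThinBox α β n j) :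
    Metric.infEDist x (surfaceS α β) ≤ ENNReal.ofReal (thickness α β n) := by
  have h0 : x 0 ∈ Set.Ioo (rightEnd β n j - thickness α β n) (rightEnd β n j) := hx 0
  have h1 : x 1 ∈ Set.Ioo (-(2 * (1 / 2) ^ n)) (0 : ℝ) := hx 1
  have h2 : x 2 ∈ Set.Ioo (0 : ℝ) ((1 / 2) ^ n) := hx 2
  let y : E3 := !₂[rightEnd β n j, x 1, x 2]
  have hy : y ∈ surfaceS α β :=
    mem_surfaceS_of_rightEnd hα hβ hi rfl ⟨h1.1.le, h1.2.le⟩ ⟨h2.1.le, h2.2.le⟩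
  refine (Metric.infEDist_le_edist_of_mem hy).trans ?_
  rw [edist_dist]
  apply ENNReal.ofReal_le_ofReal
  rw [EuclideanSpace.dist_eq, Real.sqrt_le_left (thickness_pos α β n).le, Fin.sum_univ_three]
  have e0 : y 0 = rightEnd β n j := rfl
  have e1 : y 1 = x 1 := rfl
  have e2 : y 2 = x 2 := rfl
  rw [e0, e1, e2, dist_self, dist_self, Real.dist_eq, sq_abs]
  nlinarith [h0.1, h0.2]

/-- Inside a box the distance to its right face is below the thickness, and open boxes of one
generation are disjoint. A single generation suffices: the integral dominates each weight, hence is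
infinite when they are unbounded. -/
theorem ofReal_genWeight_le {α β p : ℝ} (hα : 1 ≤ α) (hβ : 0 ≤ β) (hp : 0 ≤ p) {n : ℕ}
    (hn : 1 ≤ n) : ENNReal.ofReal (2 * genWeight α β (1 - p) n) ≤
      distIntegral (surfaceS α β) (innerPart (surfaceS α β)) p := by
  rw [distIntegral, innerPart_surfaceS hα hβ]
  have hC := thickness_pos α β n
  set J := Finset.Icc 1 (2 ^ ⌊(n : ℝ) * β⌋₊) with hJ
  have hidx : ∀ j ∈ J, IsBoxIndex β (n, j) := fun j hj =>
    ⟨hn, (Finset.mem_Icc.1 hj).1, (Finset.mem_Icc.1 hj).2⟩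
  have hsub : (⋃ j ∈ J, openThinBox α β n j) ⊆ interior (solidT α β) :=
    Set.iUnion₂_subset fun j hj => (openThinBox_subset α β n j).trans
      (interior_mono (thinBox_subset_solidT α (hidx j hj)))
  refine le_trans ?_ (lintegral_mono_set hsub)
  have hmeas : MeasurableSet (⋃ j ∈ J, openThinBox α β n j) :=
    Finset.measurableSet_biUnion _ fun j _ => measurableSet_openThinBox α β n j
  have hdisj : (J : Set ℕ).PairwiseDisjoint (openThinBox α β n) := by
    intro j hj k hk hjk
    rw [Function.onFun, Set.disjoint_left]
    intro x hxj hxk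
    have h1 := (mem_thinBox (i := (n, j)).1 (interior_subset (openThinBox_subset α β n j hxj))).1
    have h2 := (mem_thinBox (i := (n, k)).1 (interior_subset (openThinBox_subset α β n k hxk))).1
    have h3 := thickness_add_le hα hβ (hidx j hj) (hidx k hk) (by simpa using hjk)
    have h4 := abs_sub (x 0 - boxCenter α β (n, k)) (x 0 - boxCenter α β (n, j))
    rw [sub_sub_sub_cancel_left] at h4
    simp only at h1 h2 h3
    linarith
  have hvol : volume (⋃ j ∈ J, openThinBox α β n j) = ENNReal.ofReal
      (2 ^ ⌊(n : ℝ) * β⌋₊ * (2 * thickness α β n * ((1 / 2) ^ n * (1 / 2) ^ n))) := by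
    rw [measure_biUnion_finset hdisj fun j _ => measurableSet_openThinBox α β n j]
    simp only [volume_openThinBox, Finset.sum_const, hJ, Nat.card_Icc, Nat.add_sub_cancel,
      nsmul_eq_mul]
    rw [← ENNReal.ofReal_natCast, ← ENNReal.ofReal_mul (by positivity)]
    push_cast
    rfl
  have hle : ∫⁻ _ in ⋃ j ∈ J, openThinBox α β n j, ENNReal.ofReal (thickness α β n ^ (-p)) ≤
      ∫⁻ x in ⋃ j ∈ J, openThinBox α β n j, Metric.infEDist x (surfaceS α β) ^ (-p) := by
    refine setLIntegral_mono' hmeas fun x hx => ?_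
    obtain ⟨j, hj, hxj⟩ := Set.mem_iUnion₂.1 hx
    rw [← ENNReal.ofReal_rpow_of_pos hC]
    exact ennreal_rpow_neg_anti (infEDist_le_of_mem_openThinBox hα hβ (hidx j hj) hxj) hp
  refine le_trans (le_of_eq ?_) hle
  rw [setLIntegral_const, hvol, ← ENNReal.ofReal_mul (by positivity)]
  congr 1
  rw [genWeight, sub_eq_add_neg 1 p, Real.rpow_add hC, Real.rpow_one]
  ring

theorem distIntegral_innerPart_eq_top {α β p : ℝ} (hα : 1 ≤ α) (hβ : 0 ≤ β) (hp : 0 ≤ p)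
    (h : α * (1 - p) * (β + 1) < β - 2) :
    distIntegral (surfaceS α β) (innerPart (surfaceS α β)) p = ⊤ := by
  have hlim : Tendsto (fun n => ENNReal.ofReal (2 * genWeight α β (1 - p) n)) atTop (𝓝 ⊤) :=
    ENNReal.tendsto_ofReal_atTop.comp ((tendsto_genWeight hβ h).const_mul_atTop two_pos)
  refine top_le_iff.1 (le_of_tendsto hlim ?_)
  filter_upwards [eventually_ge_atTop 1] with n hn using ofReal_genWeight_le hα hβ hp hn

theorem innerMarcinkiewicz_surfaceS {α β : ℝ} (hα : 1 ≤ α) (hβ : 2 ≤ β) :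
    innerMarcinkiewicz (surfaceS α β) = ((1 - (β - 2) / (α * (β + 1)) : ℝ) : EReal) := by
  have hpos : 0 < α * (β + 1) := by nlinarith
  set s := 1 - (β - 2) / (α * (β + 1)) with hs
  have hs0 : 0 < s := by
    rw [hs, sub_pos, div_lt_one hpos]; nlinarith
  have hs1 : s ≤ 1 := by
    have : 0 ≤ (β - 2) / (α * (β + 1)) := div_nonneg (by linarith) hpos.le
    linarith
  have hse : α * (1 - s) * (β + 1) = β - 2 := by
    rw [hs]; field_simp; ring
  apply le_antisymm
  · refine iSup₂_le fun p hp => ?_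
    rw [EReal.coe_le_coe_iff]
    by_contra! hlt
    exact hp.ne (distIntegral_innerPart_eq_top hα (by linarith) (by linarith) (by nlinarith))
  · by_contra! hlt
    obtain ⟨c, hc1, hc2⟩ := EReal.lt_iff_exists_real_btwn.1 hlt
    rw [EReal.coe_lt_coe_iff] at hc2
    -- The level `c` may be negative, while the convergence estimate is for exponents `p ≥ 0`.
    have h1 : max c 0 < s := max_lt hc2 hs0
    have h2 : distIntegral (surfaceS α β) (innerPart (surfaceS α β)) (max c 0) < ⊤ :=
      distIntegral_innerPart_lt_top hα (by linarith) (le_max_right _ _) (by linarith)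
        (by nlinarith)
    have h3 : ((max c 0 : ℝ) : EReal) ≤ innerMarcinkiewicz (surfaceS α β) :=
      le_iSup₂ (f := fun (p : ℝ) (_ : distIntegral (surfaceS α β)
        (innerPart (surfaceS α β)) p < ⊤) => (p : EReal)) (max c 0) h2
    exact (h3.trans_lt hc1).not_ge (EReal.coe_le_coe_iff.2 (le_max_left c 0))

end

/-! ### ### Uncountability of the class and the main theorem -/

theorem surfaceS_injOn {β : ℝ} (hβ : 2 < β) : Set.InjOn (fun α => surfaceS α β) (Set.Ioi 1) := by
  intro a ha b hb hab
  have h1 := innerMarcinkiewicz_surfaceS (le_of_lt ha) hβ.le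
  have h2 := innerMarcinkiewicz_surfaceS (le_of_lt hb) hβ.le
  simp only at hab
  rw [hab, h2, EReal.coe_eq_coe_iff] at h1
  have ha0 : (0 : ℝ) < a := lt_trans one_pos ha
  have hb0 : (0 : ℝ) < b := lt_trans one_pos hb
  have hβ2 : β - 2 ≠ 0 := by linarith
  field_simp at h1
  have h3 : (β - 2) * a = (β - 2) * b := by linarith
  exact mul_left_cancel₀ hβ2 h3

theorem not_countable_surfaces {β : ℝ} (hβ : 2 < β) :
    ¬ {S : Set E3 | ∃ α : ℝ, 1 < α ∧ S = surfaceS α β}.Countable := by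
  have himg : {S : Set E3 | ∃ α : ℝ, 1 < α ∧ S = surfaceS α β} =
      (fun α => surfaceS α β) '' Set.Ioi 1 := by
    ext S
    simp [eq_comm]
  rw [himg]
  intro hc
  have := Set.countable_of_injective_of_countable_image (surfaceS_injOn hβ) hc
  have hle := this.le_aleph0
  rw [Cardinal.mk_Ioi_real] at hle
  exact Cardinal.aleph0_lt_continuum.not_ge hle

theorem theorem4 :
    (∀ α β : ℝ, 1 ≤ α → 2 ≤ β →
      IsJordanDomain (interior (solidT α β)) ∧
      frontier (interior (solidT α β)) = surfaceS α β ∧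
      upperMinkowskiDim (surfaceS α β) = ((3 * β / (β + 1) : ℝ) : EReal) ∧
      innerMarcinkiewicz (surfaceS α β) = ((1 - (β - 2) / (α * (β + 1)) : ℝ) : EReal)) ∧
    (∀ d : ℝ, 2 < d → d < 3 →
      2 < d / (3 - d) ∧
      ¬ {S : Set E3 | ∃ α : ℝ, 1 < α ∧ S = surfaceS α (d / (3 - d))}.Countable ∧
      ∀ α : ℝ, 1 < α →
        upperMinkowskiDim (surfaceS α (d / (3 - d))) = (d : EReal) ∧
        ∀ r : ℝ, surfaceS α (d / (3 - d)) ⊆ Metric.ball 0 r →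
          ((3 - d : ℝ) : EReal) < marcinkiewicz (surfaceS α (d / (3 - d))) r) := by
  refine ⟨fun α β hα hβ => ?_, fun d hd2 hd3 => ?_⟩
  · have hβ0 : 0 ≤ β := by linarith
    exact ⟨isJordanDomain_interior_solidT hα hβ0, frontier_interior_solidT hα hβ0,
      upperMinkowskiDim_surfaceS hα hβ, innerMarcinkiewicz_surfaceS hα hβ⟩
  · have h3 : 0 < 3 - d := by linarith
    have hβ : 2 < d / (3 - d) := by rw [lt_div_iff₀ h3]; linarith
    have hβ1 : d / (3 - d) + 1 = 3 / (3 - d) := by field_simp; ring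
    refine ⟨hβ, not_countable_surfaces hβ, fun α hα => ⟨?_, fun r _ => ?_⟩⟩
    · rw [upperMinkowskiDim_surfaceS hα.le hβ.le, hβ1]
      congr 1
      field_simp
    -- The inner exponent is already enough: here it equals `1 - (d - 2) / α`, which exceeds `3 - d`
    -- as soon as `α > 1`.
    · refine lt_of_lt_of_le ?_ (le_max_left _ _)
      rw [innerMarcinkiewicz_surfaceS hα.le hβ.le, EReal.coe_lt_coe_iff, hβ1]
      have hα0 : 0 < α := by linarith
      have e : (d / (3 - d) - 2) / (α * (3 / (3 - d))) = (d - 2) / α := by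
        field_simp; ring
      rw [e]
      have : (d - 2) / α < d - 2 := div_lt_self (by linarith) hα
      linarith
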